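/- Let $G$ be a finite simple loop-free bipartite graph, regarded as a structure with one binary relation $E(G)\subseteq V(G)^2$ (the symmetric adjacency relation). For a finite set $H$ of vertices with an arbitrary binary relation $E(H)\subseteq V(H)^2$, consider the following unital $*$-algebras generated by projection-valued measures (PVMs), each with a defect element $D_w$: * $w=c\text{-}c$: PVMs $\{\Phi^{e}_{d}\}_{d\in E(G)}$ for $e\in E(H)$, and $D_{c\text{-}c}=\frac1{|E(H)|^2}\sum |\Phi^e_d\Phi^{e'}_{d'}|^2$, the sum running over all $e,e'\in E(H)$, $d,d'\in E(G)$ for which there are $i,j\in\{1,2\}$ with $e_i=e'_j$ and $d_i\ne d'_j$; * $w=c\text{-}v$: PVMs $\{\Phi^{e}_{d}\}_{d\in E(G)}$ for $e\in E(H)$ and $\{p^x_u\}_{u\in V(G)}$ for $x\in V(H)$, and $D_{c\text{-}v}=\frac1{2|E(H)|}\sum_{e\in E(H)}\sum_{d\in E(G)}\sum_{i=1}^{2}|\Phi^e_d(1-p^{e_i}_{d_i})|^2$; * $w=a$: PVMs $\{p^x_u\}_{u\in V(G)}$ for $x\in V(H)$, and $D_{a}=\frac1{|E(H)|}\sum_{e\in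 E(H)}\sum_{(u,v)\in V(G)^2\setminus E(G)}|p^{e_1}_up^{e_2}_v|^2$; here $|y|^2=y^*y$, and $D_w=0$ if $E(H)=\varnothing$. A tracial state $\tau$ on such an algebra is Connes-embeddable if $\tau=\tau_\omega\circ\varphi$ for a unital $*$-homomorphism $\varphi$ into an ultrapower $(\mathcal R^\omega,\tau_\omega)$ of the hyperfinite $\mathrm{II}_1$ factor. For $s\le 1$, $\mathrm{CSP}_w(G)^*_{1,s}$ is the promise problem whose inputs are finite structures $H$ (encoded by their adjacency matrices); $H$ is a yes instance if some Connes-embeddable tracial state $\tau$ on the $w$-algebra has $\tau(D_w)\le 0$, and a no instance if every Connes-embeddable tracial state $\tau$ on it has $\tau(D_w)>1-s$. Then: 1. for every $w\in\{c\text{-}c,c\text{-}v,a\}$ and every real $s\le1$, the promise problem $\mathrm{CSP}_w(G)^*_{1,s}$ is in $\mathsf P$, that is, there is a polynomial-time Turing machine that outputs $1$ on all yes instances and $0$ on all no instances; 2. for every finite $H$ with a binary relation $E(H)$, the universal $C^*$-algebra $\mathrm{Mor}^+(H,G)$ generated by projections $p_{xu}$ ($x\in V(H)$, $u\in V(G)$)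 subject to $\sum_{u}p_{xu}=1$ for all $x$, and $p_{xu}p_{yv}=0$ whenever $(x,y)\in E(H)$ and $(u,v)\notin E(G)$, is nonzero if and only if there is a homomorphism $H\to G$, i.e. a map $f:V(H)\to V(G)$ with $(f(x),f(y))\in E(G)$ for all $(x,y)\in E(H)$. -/

import Mathlib

open scoped ENNReal Topology

noncomputable section

namespace EntangledCSP

/-! ### Quotients of `*`-algebras -/

/-- The involution induced on the quotient of a `*`-ring by a `*`-invariant congruence. -/
@[reducible]
def quotientStarRing {A : Type*} [Ring A] [StarRing A] (c : RingCon A)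
    (hc : ∀ a b, c a b → c (star a) (star b)) : StarRing c.Quotient where
  star := Quotient.map' star hc
  star_involutive := by
    rintro ⟨a⟩
    exact congrArg (fun x : A => (x : c.Quotient)) (star_star a)
  star_mul := by
    rintro ⟨a⟩ ⟨b⟩
    exact congrArg (fun x : A => (x : c.Quotient)) (star_mul a b)
  star_add := by
    rintro ⟨a⟩ ⟨b⟩
    exact congrArg (fun x : A => (x : c.Quotient)) (star_add a b)

theorem quotient_starModule {A : Type*} [Ring A] [StarRing A] [Algebra ℂ A] [StarModule ℂ A]
    (c : RingCon A) (hc : ∀ a b, c a b → c (star a) (star b)) :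
    letI := quotientStarRing c hc
    StarModule ℂ c.Quotient := by
  let _ := quotientStarRing c hc
  refine ⟨?_⟩
  rintro z ⟨a⟩
  exact congrArg (fun x : A => (x : c.Quotient)) (star_smul z a)

/-! ### The `*`-algebra generated by projection-valued measures -/

/-- The free unital complex algebra on the letters `X`. -/
abbrev FreeStarAlgebra (X : Type*) := MonoidAlgebra ℂ (FreeMonoid X)

/-- The antilinear map reversing words and conjugating coefficients. -/
def freeStar (X : Type*) : FreeStarAlgebra X →+ FreeStarAlgebra X :=
  (Finsupp.liftAddHom fun m : FreeMonoid X =>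
    (MonoidAlgebra.singleAddHom (R := ℂ) (star m)).comp
      (starAddEquiv : ℂ ≃+ ℂ).toAddMonoidHom).comp
    MonoidAlgebra.coeffAddEquiv.toAddMonoidHom

theorem freeStar_single {X : Type*} (m : FreeMonoid X) (z : ℂ) :
    freeStar X (MonoidAlgebra.single m z) = MonoidAlgebra.single (star m) (star z) := by
  simp [freeStar]

/-- The free algebra is a `*`-algebra in which every letter is self-adjoint. -/
instance (X : Type*) : StarRing (FreeStarAlgebra X) where
  star := freeStar X
  star_involutive := by
    intro x
    induction x using MonoidAlgebra.induction_linear with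
    | zero => simp
    | add x y hx hy => rw [map_add, map_add, hx, hy]
    | single m z => rw [freeStar_single, freeStar_single, star_star, star_star]
  star_mul := by
    intro x y
    induction x using MonoidAlgebra.induction_linear with
    | zero => simp
    | add x x' hx hx' => rw [add_mul, map_add, map_add, mul_add, hx, hx']
    | single m z =>
      induction y using MonoidAlgebra.induction_linear with
      | zero => simp
      | add y y' hy hy' => rw [mul_add, map_add, map_add, add_mul, hy, hy']
      | single m' z' =>
        rw [MonoidAlgebra.single_mul_single, freeStar_single, freeStar_single, freeStar_single,
          MonoidAlgebra.single_mul_single, star_mul, star_mul]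
  star_add := map_add (freeStar X)

instance (X : Type*) : StarModule ℂ (FreeStarAlgebra X) where
  star_smul := by
    intro c x
    change freeStar X (c • x) = star c • freeStar X x
    induction x using MonoidAlgebra.induction_linear with
    | zero => simp
    | add x y hx hy => rw [smul_add, map_add, map_add, smul_add, hx, hy]
    | single m z =>
      rw [MonoidAlgebra.smul_single, freeStar_single, freeStar_single, MonoidAlgebra.smul_single,
        smul_eq_mul, smul_eq_mul, star_mul, mul_comm]

/-- A letter of the free algebra. -/
def letter {X : Type*} (x : X) : FreeStarAlgebra X :=
  MonoidAlgebra.of ℂ (FreeMonoid X) (FreeMonoid.of x)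

theorem star_letter {X : Type*} (x : X) : star (letter x) = letter x := by
  change freeStar X (MonoidAlgebra.single _ _) = MonoidAlgebra.single _ _
  rw [freeStar_single]; simp

section PVM

variable (Q : Type*) (Ans : Q → Type*) [∀ q, Fintype (Ans q)]

/-- The defining relations of a family of PVMs `{e q a}_{a : Ans q}`, one for each `q : Q`.
Self-adjointness of the generators is part of the free `*`-algebra. -/
inductive PVMRel : FreeStarAlgebra (Σ q, Ans q) → FreeStarAlgebra (Σ q, Ans q) → Prop
  | idem (q : Q) (a : Ans q) :
      PVMRel (letter (X := Σ q, Ans q) ⟨q, a⟩ * letter ⟨q, a⟩) (letter ⟨q, a⟩)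
  | orth (q : Q) (a b : Ans q) (h : a ≠ b) :
      PVMRel (letter (X := Σ q, Ans q) ⟨q, a⟩ * letter ⟨q, b⟩) 0
  | sum (q : Q) : PVMRel (∑ a : Ans q, letter (X := Σ q, Ans q) ⟨q, a⟩) 1

theorem PVMRel.star {x y : FreeStarAlgebra (Σ q, Ans q)} (h : PVMRel Q Ans x y) :
    PVMRel Q Ans (star x) (star y) := by
  cases h with
  | idem q a => simpa [star_mul, star_letter] using PVMRel.idem q a
  | orth q a b h => simpa [star_mul, star_letter] using PVMRel.orth q b a h.symm
  | sum q => simpa [star_sum, star_letter] using PVMRel.sum (Ans := Ans) q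

/-- The universal unital `*`-algebra generated by PVMs `{e q a}_{a : Ans q}` for `q : Q`. -/
abbrev PVMAlgebra := (ringConGen (PVMRel Q Ans)).Quotient

instance : StarRing (PVMAlgebra Q Ans) :=
  quotientStarRing _ (ringConGen_star fun _ _ h => PVMRel.star Q Ans h)

instance : StarModule ℂ (PVMAlgebra Q Ans) :=
  quotient_starModule _ (ringConGen_star fun _ _ h => PVMRel.star Q Ans h)

variable {Q Ans}

/-- The generator `e q a` of the PVM algebra. -/
def gen (q : Q) (a : Ans q) : PVMAlgebra Q Ans :=
  ((letter ⟨q, a⟩ : FreeStarAlgebra (Σ q, Ans q)) : (ringConGen (PVMRel Q Ans)).Quotient)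

end PVM

/-! ### Tracial states -/

/-- Tracial states of a unital complex `*`-algebra (positivity is with respect to the
sum-of-squares cone). -/
structure IsTracialState {A : Type*} [Ring A] [StarRing A] [Algebra ℂ A] (τ : A →ₗ[ℂ] ℂ) :
    Prop where
  map_one : τ 1 = 1
  re_nonneg : ∀ x, 0 ≤ (τ (star x * x)).re
  im_zero : ∀ x, (τ (star x * x)).im = 0
  tracial : ∀ x y, τ (x * y) = τ (y * x)


/-! ### The hyperfinite II₁ factor and its ultrapower -/

/-- The Hilbert space of square-summable complex families. -/
abbrev Ell2 (I : Type*) := lp (fun _ : I => ℂ) 2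

/-- Permutation of coordinates on `ℓ²(I)`, sending the basis vector `δ i` to `δ (e i)`. -/
def permOp {I : Type*} (e : Equiv.Perm I) : Ell2 I →L[ℂ] Ell2 I :=
  LinearIsometry.toContinuousLinearMap
    { toFun := fun f => ⟨fun i => f (e.symm i), by
        have h := (memℓp_gen_iff (by norm_num)).1 (lp.memℓp f)
        exact (memℓp_gen_iff (E := fun _ : I => ℂ) (by norm_num)).2
          ((e.symm.summable_iff (f := fun i => ‖f i‖ ^ (2 : ℝ≥0∞).toReal)).2 h)⟩
      map_add' := fun _ _ => rfl
      map_smul' := fun _ _ => rfl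
      norm_map' := fun f => by
        rw [lp.norm_eq_tsum_rpow (by norm_num), lp.norm_eq_tsum_rpow (by norm_num)]
        congr 1
        exact e.symm.tsum_eq (fun i => ‖f i‖ ^ (2 : ℝ≥0∞).toReal) }

theorem permOp_apply {I : Type*} (e : Equiv.Perm I) (f : Ell2 I) (i : I) :
    permOp e f i = f (e.symm i) := rfl

open Classical in
/-- The basis vector `δ i`. -/
def delta {I : Type*} (i : I) : Ell2 I := lp.single 2 i 1

/-- The von Neumann algebra of the group `Γ`: the double commutant of the left regular
representation on `ℓ²(Γ)`. -/
def groupVN (Γ : Type*) [Group Γ] : StarSubalgebra ℂ (Ell2 Γ →L[ℂ] Ell2 Γ) :=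
  StarSubalgebra.centralizer ℂ (StarSubalgebra.centralizer ℂ
    (Set.range fun g : Γ => permOp (Equiv.mulLeft g)) : Set (Ell2 Γ →L[ℂ] Ell2 Γ))

/-- The canonical trace `x ↦ ⟨δ 1, x δ 1⟩`. -/
def groupTrace {Γ : Type*} [Group Γ] (x : Ell2 Γ →L[ℂ] Ell2 Γ) : ℂ :=
  inner ℂ (delta (1 : Γ)) (x (delta 1))

/-- The group of finitely supported permutations of `ℕ`. It is locally finite and all its
nontrivial conjugacy classes are infinite, so its von Neumann algebra is the hyperfinite
II₁ factor. -/
def FinPerm : Subgroup (Equiv.Perm ℕ) where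
  carrier := {s | {n | s n ≠ n}.Finite}
  mul_mem' := by
    intro s t hs ht
    refine (hs.union ht).subset fun n hn => ?_
    by_contra h
    simp only [Set.mem_union, Set.mem_ofPred_eq, not_or, not_not] at h
    exact hn (by simp [h.1, h.2])
  one_mem' := by simp
  inv_mem' := by
    intro s hs
    refine Set.Finite.subset hs fun n hn => ?_
    intro h
    exact hn (by rw [Equiv.Perm.inv_eq_iff_eq]; exact h.symm)

/-- The hyperfinite II₁ factor `R`. -/
def HypR : StarSubalgebra ℂ (Ell2 FinPerm →L[ℂ] Ell2 FinPerm) := groupVN FinPerm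

/-- Operator-norm-bounded sequences in `R`, as a subalgebra of all sequences of operators. -/
def bddSeq : StarSubalgebra ℂ (ℕ → Ell2 FinPerm →L[ℂ] Ell2 FinPerm) where
  carrier := {x | (∀ n, x n ∈ HypR) ∧ ∃ C : ℝ, ∀ n, ‖x n‖ ≤ C}
  mul_mem' := by
    rintro x y ⟨hx, C, hC⟩ ⟨hy, D, hD⟩
    refine ⟨fun n => mul_mem (hx n) (hy n), C * D, fun n => ?_⟩
    exact (norm_mul_le _ _).trans
      (mul_le_mul (hC n) (hD n) (norm_nonneg _) ((norm_nonneg _).trans (hC n)))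
  add_mem' := by
    rintro x y ⟨hx, C, hC⟩ ⟨hy, D, hD⟩
    exact ⟨fun n => add_mem (hx n) (hy n), C + D,
      fun n => (norm_add_le _ _).trans (add_le_add (hC n) (hD n))⟩
  algebraMap_mem' := by
    intro z
    exact ⟨fun n => HypR.algebraMap_mem z, ‖algebraMap ℂ (Ell2 FinPerm →L[ℂ] Ell2 FinPerm) z‖,
      fun n => le_rfl⟩
  star_mem' := by
    rintro x ⟨hx, C, hC⟩
    exact ⟨fun n => star_mem (hx n), C, fun n => (norm_star (x n)).trans_le (hC n)⟩

/-- The `*`-algebra `ℓ^∞(ℕ, R)` of operator-norm-bounded sequences in `R`. -/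
def BddSeqR : Type := bddSeq

instance : Ring BddSeqR := inferInstanceAs (Ring bddSeq)

instance : StarRing BddSeqR := inferInstanceAs (StarRing bddSeq)

instance : Algebra ℂ BddSeqR := inferInstanceAs (Algebra ℂ bddSeq)

instance : StarModule ℂ BddSeqR := inferInstanceAs (StarModule ℂ bddSeq)

theorem permOp_delta {I : Type*} (e : Equiv.Perm I) (i : I) :
    permOp e (delta i) = delta (e i) := by
  ext j
  rw [permOp_apply]
  simp only [delta, lp.single_apply, Pi.single_apply]
  by_cases h : j = e i <;> simp [h, Equiv.symm_apply_eq]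

theorem delta_inner {I : Type*} (i : I) (f : Ell2 I) : inner ℂ (delta i) f = f i := by
  classical
  have h := lp.inner_single_left (𝕜 := ℂ) (G := fun _ : I => ℂ) i (1 : ℂ) f
  have h2 : delta i = lp.single (E := fun _ : I => ℂ) 2 i (1 : ℂ) := by
    unfold delta; congr
  rw [h2, h]; simp

theorem norm_star_delta {Γ : Type*} [Group Γ] {x : Ell2 Γ →L[ℂ] Ell2 Γ} (hx : x ∈ groupVN Γ) :
    ‖star x (delta (1 : Γ))‖ = ‖x (delta (1 : Γ))‖ := by
  have hcomm : ∀ g : Γ, x * permOp (Equiv.mulRight g) = permOp (Equiv.mulRight g) * x := by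
    intro g
    have hg : permOp (Equiv.mulRight g) ∈ StarSubalgebra.centralizer ℂ
        (Set.range fun g : Γ => permOp (Equiv.mulLeft g)) := by
      rw [StarSubalgebra.mem_centralizer_iff]
      rintro _ ⟨h, rfl⟩
      have e1 : star (permOp (Equiv.mulLeft h)) = permOp (Equiv.mulLeft h⁻¹) := by
        rw [ContinuousLinearMap.star_eq_adjoint, eq_comm, ContinuousLinearMap.eq_adjoint_iff]
        intro a b
        rw [lp.inner_eq_tsum, lp.inner_eq_tsum,
          ← (Equiv.mulLeft h).tsum_eq (fun i => inner ℂ (a i) (permOp (Equiv.mulLeft h) b i))]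
        simp [permOp_apply]
      have e2 : ∀ k : Γ, permOp (Equiv.mulLeft k) * permOp (Equiv.mulRight g)
          = permOp (Equiv.mulRight g) * permOp (Equiv.mulLeft k) := by
        intro k
        ext f i
        simp [permOp_apply, mul_assoc]
      exact ⟨e2 h, by rw [e1]; exact e2 _⟩
    exact ((StarSubalgebra.mem_centralizer_iff ℂ).1 hx _ hg).1.symm
  have key : ∀ g : Γ, (star x (delta (1 : Γ))) g = star ((x (delta (1 : Γ))) g⁻¹) := by
    intro g
    rw [← delta_inner g, ← delta_inner g⁻¹, ContinuousLinearMap.star_eq_adjoint,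
      ContinuousLinearMap.adjoint_inner_right]
    have h1 : x (delta g) = permOp (Equiv.mulRight g) (x (delta 1)) := by
      have := DFunLike.congr_fun (hcomm g) (delta 1)
      simpa [permOp_delta] using this
    rw [← inner_conj_symm, h1, delta_inner, delta_inner, permOp_apply]
    simp
  rw [lp.norm_eq_tsum_rpow (by norm_num), lp.norm_eq_tsum_rpow (by norm_num)]
  congr 1
  rw [← (Equiv.inv Γ).tsum_eq]
  refine tsum_congr fun g => ?_
  rw [key]
  simp

/-- The free ultrafilter on `ℕ` along which the ultrapower is taken. -/
def om : Filter ℕ := (Filter.hyperfilter ℕ : Filter ℕ)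

/-- A bounded sequence is null if its trace norms `‖x n‖₂ = τ((x n)^* (x n))^{1/2} = ‖x n δ 1‖`
tend to `0` along the ultrafilter. -/
def IsNull (x : BddSeqR) : Prop :=
  Filter.Tendsto (fun n => ‖x.1 n (delta 1)‖) om (𝓝 0)

theorem IsNull.add {x y : BddSeqR} (hx : IsNull x) (hy : IsNull y) : IsNull (x + y) := by
  have h := Filter.Tendsto.add hx hy
  rw [add_zero] at h
  exact squeeze_zero (fun _ => norm_nonneg _) (fun n => norm_add_le _ _) h

theorem IsNull.neg {x : BddSeqR} (hx : IsNull x) : IsNull (-x) := by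
  refine Filter.Tendsto.congr (fun n => ?_) hx
  exact (norm_neg (x.1 n (delta 1))).symm

theorem IsNull.star' {x : BddSeqR} (hx : IsNull x) : IsNull (star x) :=
  Filter.Tendsto.congr (fun n => (norm_star_delta (x.2.1 n)).symm) hx

theorem IsNull.mul_left {x : BddSeqR} (y : BddSeqR) (hx : IsNull x) : IsNull (y * x) := by
  obtain ⟨C, hC⟩ := y.2.2
  have h := Filter.Tendsto.const_mul C hx
  rw [mul_zero] at h
  refine squeeze_zero (fun _ => norm_nonneg _) (fun n => ?_) h
  exact ((y.1 n).le_opNorm (x.1 n (delta 1))).trans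
    (mul_le_mul_of_nonneg_right (hC n) (norm_nonneg _))

theorem norm_mul_delta {x y : Ell2 FinPerm →L[ℂ] Ell2 FinPerm} (hx : x ∈ HypR) (hy : y ∈ HypR) :
    ‖(x * y) (delta 1)‖ ≤ ‖y‖ * ‖x (delta 1)‖ := by
  have h1 : ‖(x * y) (delta 1)‖ = ‖star y (star x (delta 1))‖ := by
    rw [← norm_star_delta (mul_mem hx hy), star_mul]; rfl
  have h2 := (star y).le_opNorm (star x (delta 1))
  have h3 : ‖star y‖ = ‖y‖ := norm_star y
  rw [h3, norm_star_delta hx, ← h1] at h2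
  exact h2

theorem IsNull.mul_right {x : BddSeqR} (y : BddSeqR) (hx : IsNull x) : IsNull (x * y) := by
  obtain ⟨C, hC⟩ := y.2.2
  have h := Filter.Tendsto.const_mul C hx
  rw [mul_zero] at h
  refine squeeze_zero (fun _ => norm_nonneg _) (fun n => ?_) h
  exact (norm_mul_delta (x.2.1 n) (y.2.1 n)).trans
    (mul_le_mul_of_nonneg_right (hC n) (norm_nonneg _))

theorem IsNull.zero : IsNull 0 := by
  refine Filter.Tendsto.congr (f₁ := fun _ => (0 : ℝ)) (fun n => ?_) tendsto_const_nhds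
  exact (norm_zero (E := Ell2 FinPerm)).symm

theorem IsNull.mul_sub_mul {a b c d : BddSeqR} (h : IsNull (a - b)) (h' : IsNull (c - d)) :
    IsNull (a * c - b * d) := by
  have e : (a - b) * c + b * (c - d) = a * c - b * d :=
    (congrArg₂ (· + ·) (sub_mul a b c) (mul_sub b c d)).trans (sub_add_sub_cancel _ _ _)
  exact e ▸ (h.mul_right c).add (h'.mul_left b)

theorem IsNull.add_sub_add {a b c d : BddSeqR} (h : IsNull (a - b)) (h' : IsNull (c - d)) :
    IsNull (a + c - (b + d)) := by
  have e : (a - b) + (c - d) = a + c - (b + d) := sub_add_sub_comm a b c d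
  exact e ▸ h.add h'

theorem IsNull.sub_symm {a b : BddSeqR} (h : IsNull (a - b)) : IsNull (b - a) := by
  have e : -(a - b) = b - a := neg_sub a b
  exact e ▸ h.neg

theorem IsNull.sub_trans {a b c : BddSeqR} (h : IsNull (a - b)) (h' : IsNull (b - c)) :
    IsNull (a - c) := by
  have e : (a - b) + (b - c) = a - c := sub_add_sub_cancel a b c
  exact e ▸ h.add h'

theorem IsNull.sub_self (a : BddSeqR) : IsNull (a - a) := by
  have e : 0 = a - a := (_root_.sub_self a).symm
  exact e ▸ IsNull.zero

/-- Equality in the ultrapower. -/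
def nullCon : RingCon BddSeqR where
  r x y := IsNull (x - y)
  iseqv := ⟨IsNull.sub_self, IsNull.sub_symm, IsNull.sub_trans⟩
  add' := IsNull.add_sub_add
  mul' := IsNull.mul_sub_mul

/-- The tracial ultrapower `R^ω` of the hyperfinite II₁ factor: bounded sequences modulo
null sequences. -/
def UltraR : Type := nullCon.Quotient

instance : Ring UltraR := inferInstanceAs (Ring nullCon.Quotient)

instance : Algebra ℂ UltraR := inferInstanceAs (Algebra ℂ nullCon.Quotient)

theorem nullCon_star (a b : BddSeqR) (h : nullCon a b) : nullCon (star a) (star b) := by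
  have e : star (a - b) = star a - star b := star_sub a b
  have h' := IsNull.star' (x := a - b) h
  change IsNull (star a - star b)
  exact e ▸ h'

instance : StarRing UltraR := quotientStarRing nullCon nullCon_star

instance : StarModule ℂ UltraR := quotient_starModule nullCon nullCon_star

/-- The class of a bounded sequence in `R^ω`. -/
def ultraMk (x : BddSeqR) : UltraR := (x : nullCon.Quotient)

/-- `c` is the value at `y` of the trace `τ_ω([x]) = lim_{n → ω} τ(x n)` of `R^ω`. -/
def HasUltraTrace (y : UltraR) (c : ℂ) : Prop :=
  ∃ x : BddSeqR, ultraMk x = y ∧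
    Filter.Tendsto (fun n => groupTrace (x.1 n)) om (𝓝 c)

/-- A tracial state is Connes-embeddable if it is the pullback of the trace of `R^ω` along a
unital `*`-homomorphism into `R^ω`. -/
def IsConnesEmbeddable {A : Type*} [Ring A] [StarRing A] [Algebra ℂ A] (τ : A →ₗ[ℂ] ℂ) : Prop :=
  ∃ φ : A →⋆ₐ[ℂ] UltraR, ∀ a, HasUltraTrace (φ a) (τ a)

/-! ### The weighted algebras of a pair of binary structures

A relational structure with a single binary relation is a `Digraph`; loops are allowed. -/

/-- The pairs in the relation. -/
abbrev Edge {V : Type*} (D : Digraph V) := {e : V × V // D.Adj e.1 e.2}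

instance {V : Type*} [Fintype V] (D : Digraph V) : Fintype (Edge D) := Fintype.ofFinite _

/-- The two coordinates of a pair in the relation. -/
def Edge.coord {V : Type*} {D : Digraph V} (e : Edge D) : Fin 2 → V := ![e.1.1, e.1.2]

/-- A graph seen as a binary relational structure. -/
def ofGraph {V : Type*} (G : SimpleGraph V) : Digraph V := ⟨G.Adj⟩

/-- The defect polynomial `∑ i, μ i • (x i)^* (x i)` of a finite weighted family. -/
def defectPoly {A ι : Type*} [Fintype ι] [Ring A] [StarRing A] [Algebra ℂ A]
    (μ : ι → ℝ) (x : ι → A) : A :=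
  ∑ i, (μ i : ℂ) • (star (x i) * x i)

/-- The weight of a point for the uniform distribution on `X`. -/
def unif (X : Type*) [Fintype X] : ℝ := 1 / Fintype.card X

section Models

variable {W V : Type*} [Fintype W] [Fintype V] (B : Digraph W) (A : Digraph V)

/-- The constraint-constraint algebra, generated by PVMs `{Φ e d}_{d ∈ E(A)}`, `e ∈ E(B)`. -/
abbrev MorCC := PVMAlgebra (Edge B) (fun _ => Edge A)

open Classical in
/-- The constraint-constraint defect polynomial for the uniform distribution on `E(B)²`:
`Φ e d * Φ e' d'` is penalised when `d` and `d'` disagree on a common variable. -/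
def defectCC : MorCC B A :=
  defectPoly (ι := (Edge B × Edge B) × (Edge A × Edge A))
    (fun k => if ∃ i j, k.1.1.coord i = k.1.2.coord j ∧ k.2.1.coord i ≠ k.2.2.coord j
      then unif (Edge B × Edge B) else 0)
    (fun k => gen k.1.1 k.2.1 * gen k.1.2 k.2.2)

/-- Answers in the constraint-variable algebra. -/
def AnsCV : Edge B ⊕ W → Type _
  | .inl _ => Edge A
  | .inr _ => V

instance : ∀ q, Fintype (AnsCV B A q)
  | .inl _ => inferInstanceAs (Fintype (Edge A))
  | .inr _ => inferInstanceAs (Fintype V)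

/-- The constraint-variable algebra, generated by PVMs `{Φ e d}_{d ∈ E(A)}`, `e ∈ E(B)`, and
`{p b a}_{a ∈ A}`, `b ∈ B`. -/
abbrev MorCV := PVMAlgebra (Edge B ⊕ W) (AnsCV B A)

/-- The constraint-variable defect polynomial for the uniform distribution on `E(B)`:
`Φ e d * (1 - p (e i) (d i))` is penalised. -/
def defectCV : MorCV B A :=
  defectPoly (ι := Edge B × Edge A × Fin 2)
    (fun _ => unif (Edge B) / 2)
    (fun k => gen (Ans := AnsCV B A) (.inl k.1) k.2.1 *
      (1 - gen (Ans := AnsCV B A) (.inr (k.1.coord k.2.2)) (k.2.1.coord k.2.2)))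

/-- The assignment algebra, generated by PVMs `{p b a}_{a ∈ A}`, `b ∈ B`. -/
abbrev MorA := PVMAlgebra W (fun _ => V)

open Classical in
/-- The assignment defect polynomial for the uniform distribution on `E(B)`:
`p (e 0) a * p (e 1) a'` is penalised when `(a, a') ∉ E(A)`. -/
def defectA : MorA (W := W) (V := V) :=
  defectPoly (ι := Edge B × V × V)
    (fun k => if A.Adj k.2.1 k.2.2 then 0 else unif (Edge B))
    (fun k => gen (k.1.coord 0) k.2.1 * gen (k.1.coord 1) k.2.2)

end Models

/-- The values `τ(D)` for `τ` a Connes-embeddable tracial state. -/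
def connesValues {A : Type*} [Ring A] [StarRing A] [Algebra ℂ A] (D : A) : Set ℝ :=
  {r | ∃ τ : A →ₗ[ℂ] ℂ, IsTracialState τ ∧ IsConnesEmbeddable τ ∧ r = (τ D).re}

/-- The three ways of presenting a CSP as a nonlocal game: constraint-constraint,
constraint-variable and assignment. -/
inductive Model
  | cc
  | cv
  | a

/-- The defects of Connes-embeddable traces on the weighted algebra `Mor^w(B, A)` with the
uniform distribution. -/
def defects {W V : Type*} [Fintype W] [Fintype V] (w : Model) (B : Digraph W) (A : Digraph V) :
    Set ℝ :=
  match w with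
  | .cc => connesValues (defectCC B A)
  | .cv => connesValues (defectCV B A)
  | .a => connesValues (defectA B A)

/-! ### Promise problems and polynomial time -/

/-- A promise problem over binary words. -/
structure PromiseProblem where
  yes : Set (List Bool)
  no : Set (List Bool)
  disjoint : Disjoint yes no

/-- The machine `M` outputs the single bit `b` on input `x` after at most `t` steps. -/
def OutputsWithin (M : Turing.TM2ComputableAux Bool Bool) (x : List Bool) (b : Bool) (t : ℕ) :
    Prop :=
  Nonempty (Turing.TM2OutputsInTime M.tm (x.map M.inputAlphabet.symm)
    (some [M.outputAlphabet.symm b]) t)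

/-- The class P of promise problems decided by a Turing machine in polynomial time. -/
def classP : Set PromiseProblem :=
  {P | ∃ (M : Turing.TM2ComputableAux Bool Bool) (p : Polynomial ℕ),
    (∀ x ∈ P.yes, OutputsWithin M x true (p.eval x.length)) ∧
    (∀ x ∈ P.no, OutputsWithin M x false (p.eval x.length))}

open Classical in
/-- Binary encoding of a structure on `{0, …, n - 1}`: `n` in unary, a separator, and the
adjacency matrix row by row. -/
def encode {n : ℕ} (B : Digraph (Fin n)) : List Bool :=
  List.replicate n true ++
    false :: (List.ofFn fun i => List.ofFn fun j => decide (B.Adj i j)).flatten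

theorem encode_inj {n m : ℕ} {B : Digraph (Fin n)} {C : Digraph (Fin m)}
    (h : encode B = encode C) : (⟨n, B⟩ : Σ k, Digraph (Fin k)) = ⟨m, C⟩ := by
  classical
  have hn : n = m := by
    have h1 := congrArg (fun l => (l.takeWhile id).length) h
    simpa [encode, List.takeWhile_append] using h1
  subst hn
  congr 1
  have h2 := List.append_cancel_left h
  rw [List.cons.injEq] at h2
  have h3 := List.eq_iff_flatten_eq.2 ⟨h2.2, by simp [List.map_ofFn, Function.comp_def]⟩
  have h4 := List.ofFn_injective h3
  ext i j
  have h5 := congrFun (List.ofFn_injective (congrFun h4 i)) j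
  simpa using h5

/-- The `(c, s)`-gapped `w`-entangled CSP of the binary structure `A`. -/
def entangledCSP {V : Type*} [Fintype V] (w : Model) (A : Digraph V) (c s : ℝ) (hs : s ≤ c) :
    PromiseProblem where
  yes := {x | ∃ (n : ℕ) (B : Digraph (Fin n)), encode B = x ∧ ∃ r ∈ defects w B A, r ≤ 1 - c}
  no := {x | ∃ (n : ℕ) (B : Digraph (Fin n)), encode B = x ∧ ∀ r ∈ defects w B A, 1 - s < r}
  disjoint := by
    rw [Set.disjoint_left]
    rintro x ⟨n, B, rfl, r, hr, hle⟩ ⟨m, C, hC, hlt⟩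
    have e := encode_inj hC
    cases e
    have := hlt r hr
    linarith

/-! ### The quantum space of homomorphisms -/

/-- Operators on a fixed infinite-dimensional separable Hilbert space. -/
abbrev Op := Ell2 ℕ →L[ℂ] Ell2 ℕ

section QuantumHom

variable {W V : Type*} [Fintype V] (B : Digraph W) (A : Digraph V)

/-- Representations on `ℓ²(ℕ)` of the relations defining `Mor⁺(B, A)`: projections `p b a` with
`∑ a, p b a = 1` and `p b a * p b' a' = 0` whenever `(b, b') ∈ E(B)` and `(a, a') ∉ E(A)`. -/
structure QRep where
  p : W → V → Op
  proj : ∀ b a, IsStarProjection (p b a)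
  sum_eq : ∀ b, ∑ a, p b a = 1
  rel : ∀ b b' a a', B.Adj b b' → ¬ A.Adj a a' → p b a * p b' a' = 0

instance : TopologicalSpace (QRep B A) := ⊥

instance : DiscreteTopology (QRep B A) := ⟨rfl⟩

instance : NormedRing (BoundedContinuousFunction (QRep B A) Op) := inferInstance

instance : CStarRing (BoundedContinuousFunction (QRep B A) Op) := inferInstance

/-- The generator `p b a` in the universal representation. -/
def qgen (b : W) (a : V) : BoundedContinuousFunction (QRep B A) Op :=
  BoundedContinuousFunction.ofNormedAddCommGroupDiscrete (fun ρ => ρ.p b a) 1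
    fun ρ => (ρ.proj b a).norm_le

/-- The universal C*-algebra `Mor⁺(B, A)` on generators `p b a` subject to the above relations,
realised as the norm-closed `*`-algebra generated by them in the C*-algebra of bounded
families of operators indexed by all representations.
As it has finitely many generators, representations on the separable space `ℓ²(ℕ)` (infinite
amplifications of arbitrary separable ones) compute its norm. -/
def MorPlus : StarSubalgebra ℂ (BoundedContinuousFunction (QRep B A) Op) :=
  (StarAlgebra.adjoin ℂ (Set.range fun k : W × V => qgen B A k.1 k.2)).topologicalClosure

end QuantumHom

end EntangledCSP

end

namespace EntangledCSP

/-! Fix a two-colouring `κ` of `G`. In any nonzero ring with operator solutions of the constraints,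
let `q x` be the sum of the members of the measure at `x` whose answer has colour `true`. Along an
edge `(x, y)` of `H` bipartiteness forces `q x * q y = 0` and `q x + q y = 1`, so `q` alternates
between an element and its complement. These two elements differ, since otherwise `q x = 0` and `0 =
1`; choosing one of them consistently is a classical two-colouring of `H`
(`exists_coloring_of_idempotents`). If `H` has an edge then so does `G`, and `H` maps to `G` through
a single edge of `G`. For `MorPlus` this argument applies in any representation.

For the games, a trace of defect zero kills `τ (star x * x)` for every penalised `x`. By a
Cauchy–Schwarz argument (`IsTracialState.map_mul_eq_zero`) `x` vanishes in the quotient by the null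
ideal of `τ`, which is a nonzero ring because `τ 1 = 1`. The exact relations therefore hold there,
and `feasible_of_defect_nonpos` produces the colouring. Conversely a homomorphism gives a character
of the PVM algebra, which is a Connes-embeddable trace of defect zero through the scalars of
`UltraR` (`zero_mem_defects`). As `1 - s ≥ 0`, no instances cannot be feasible, so deciding
`Feasible`, corrected for empty vertex sets, solves the promise problem.

This condition is a system of parity constraints with entries read off from the adjacency matrix
(`exists_satisfiable_iff_feasible`). Eliminating one vertex at a time (`satisfiable_iff_eliminate`)
decides such a system in cubically many steps of an explicit stack machine (`Solver.run_solve`). -/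

/-! ### Runs of a transition function -/

/-- The transition function `f` leads from `c` to `c'` in at most `T` steps. -/
def RunsIn {α : Type*} (f : α → Option α) (T : ℕ) (c c' : α) : Prop :=
  Nonempty (StateTransition.EvalsToInTime f c (some c') T)

namespace RunsIn

variable {α : Type*} {f : α → Option α}

theorem of_step {c c' : α} (h : f c = some c') : RunsIn f 1 c c' :=
  ⟨⟨⟨1, h⟩, le_rfl⟩⟩

theorem trans {T T' : ℕ} {c c' c'' : α} (h : RunsIn f T c c') (h' : RunsIn f T' c' c'') :
    RunsIn f (T + T') c c'' := by
  obtain ⟨h⟩ := h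
  obtain ⟨h'⟩ := h'
  have := StateTransition.EvalsToInTime.trans f _ _ _ _ _ h h'
  rw [add_comm]
  exact ⟨this⟩

theorem mono {T T' : ℕ} {c c' : α} (h : RunsIn f T c c') (hT : T ≤ T') : RunsIn f T' c c' := by
  obtain ⟨h⟩ := h
  exact ⟨⟨h.toEvalsTo, h.steps_le_m.trans hT⟩⟩

theorem head {T : ℕ} {c c' c'' : α} (h : f c = some c') (h' : RunsIn f T c' c'') :
    RunsIn f (T + 1) c c'' :=
  ((of_step h).trans h').mono (by omega)

theorem of_eq {T T' : ℕ} {c e e' : α} (h : RunsIn f T c e') (he : e' = e) (hT : T ≤ T') :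
    RunsIn f T' c e :=
  he ▸ h.mono hT

theorem head_of_eq {T T' : ℕ} {c d e e' : α} (h : f c = some d) (h' : RunsIn f T d e')
    (he : e' = e) (hT : T + 1 ≤ T') : RunsIn f T' c e :=
  (head h h').of_eq he hT

end RunsIn

/-! ### Parity constraints -/

/-- A set of admissible parities imposed on a pair of bits: the first component demands that
the two bits agree, the second one that they differ. -/
abbrev Parity := Bool × Bool

namespace Parity

/-- The pair `(x, y)` satisfies the constraint `e`. -/
def Holds (e : Parity) (x y : Bool) : Prop := (e.1 = true → x = y) ∧ (e.2 = true → x ≠ y)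

/-- Conjunction of two constraints on the same pair. -/
def join (e f : Parity) : Parity := (e.1 || f.1, e.2 || f.2)

/-- The constraint on `(x, z)` implied by constraints on `(x, y)` and `(y, z)`. -/
def comp (e f : Parity) : Parity := (e.1 && f.1 || e.2 && f.2, e.1 && f.2 || e.2 && f.1)

theorem holds_join {e f : Parity} {x y : Bool} :
    (join e f).Holds x y ↔ e.Holds x y ∧ f.Holds x y := by
  rcases e with ⟨_ | _, _ | _⟩ <;> rcases f with ⟨_ | _, _ | _⟩ <;> cases x <;> cases y <;>
    simp [join, Holds]

theorem holds_comm {e : Parity} {x y : Bool} : e.Holds x y ↔ e.Holds y x := by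
  rcases e with ⟨_ | _, _ | _⟩ <;> cases x <;> cases y <;> simp [Holds]

theorem holds_comp {e f : Parity} {x y z : Bool} (h : e.Holds x y) (h' : f.Holds y z) :
    (comp e f).Holds x z := by
  revert h h'
  rcases e with ⟨_ | _, _ | _⟩ <;> rcases f with ⟨_ | _, _ | _⟩ <;> cases x <;> cases y <;>
    cases z <;> simp [comp, Holds]

theorem holds_self {e : Parity} {x : Bool} : e.Holds x x ↔ e.2 = false := by
  rcases e with ⟨_ | _, _ | _⟩ <;> cases x <;> simp [Holds]

/-- If `e` is not void, then a composite constraint forces a value on the middle vertex. -/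
theorem holds_of_comp {e f : Parity} {x z : Bool} (he : e ≠ (false, false))
    (h : (comp e f).Holds x z) : f.Holds (x ^^ e.2) z := by
  revert he h
  rcases e with ⟨_ | _, _ | _⟩ <;> rcases f with ⟨_ | _, _ | _⟩ <;> cases x <;>
    cases z <;> simp [comp, Holds]

end Parity

/-- A matrix of parity constraints is satisfiable if some bit assignment meets all of them. -/
def Satisfiable {n : ℕ} (M : Fin n → Fin n → Parity) : Prop :=
  ∃ c : Fin n → Bool, ∀ i j, (M i j).Holds (c i) (c j)

/-- The constraints between the vertex `0` and the other ones. -/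
def pivotRow {n : ℕ} (M : Fin (n + 1) → Fin (n + 1) → Parity) (i : Fin n) : Parity :=
  (M 0 i.succ).join (M i.succ 0)

/-- Elimination of the vertex `0`. -/
def eliminate {n : ℕ} (M : Fin (n + 1) → Fin (n + 1) → Parity) (i j : Fin n) : Parity :=
  (M i.succ j.succ).join ((pivotRow M i).comp (pivotRow M j))

/-- Constraints through the vertex `0` compose to constraints between its neighbours, and nothing is
lost: one nonvoid constraint at `0` already determines its bit, and the composites make all others
agree with that bit. A diagonal entry is violated exactly when it demands a difference. -/
theorem satisfiable_iff_eliminate {n : ℕ} (M : Fin (n + 1) → Fin (n + 1) → Parity) :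
    Satisfiable M ↔ (M 0 0).2 = false ∧ Satisfiable (eliminate M) := by
  constructor
  · rintro ⟨c, hc⟩
    have ha : ∀ i : Fin n, (pivotRow M i).Holds (c 0) (c i.succ) := fun i =>
      Parity.holds_join.2 ⟨hc _ _, Parity.holds_comm.1 (hc _ _)⟩
    refine ⟨Parity.holds_self.1 (hc 0 0), fun i => c i.succ, fun i j => ?_⟩
    exact Parity.holds_join.2 ⟨hc _ _, Parity.holds_comp (Parity.holds_comm.1 (ha i)) (ha j)⟩
  · rintro ⟨h0, c, hc⟩
    obtain ⟨x, hx⟩ : ∃ x, ∀ i : Fin n, (pivotRow M i).Holds x (c i) := by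
      by_cases h : ∃ i, pivotRow M i ≠ (false, false)
      · obtain ⟨i, hi⟩ := h
        -- The bit of the vertex `0` is `c i ^^ (pivotRow M i).2`, the value forced by its neighbour
        -- `i`.
        exact ⟨_, fun j => Parity.holds_of_comp hi (Parity.holds_join.1 (hc i j)).2⟩
      · push Not at h
        exact ⟨true, fun i => by simp [h i, Parity.Holds]⟩
    refine ⟨Fin.cons x c, fun i j => ?_⟩
    refine Fin.cases ?_ (fun i => ?_) i <;> refine Fin.cases ?_ (fun j => ?_) j
    · exact Parity.holds_self.2 h0
    · exact (Parity.holds_join.1 (hx j)).1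
    · exact Parity.holds_comm.1 (Parity.holds_join.1 (hx i)).2
    · exact (Parity.holds_join.1 (hc i j)).1

/-! ### A stack machine deciding satisfiability -/

namespace Solver

/-- The stacks of the machine. -/
inductive Stk
  | inp | out | size | size' | mat | mat' | row | piv | piv' | scal
  deriving DecidableEq

instance : Fintype Stk :=
  ⟨{.inp, .out, .size, .size', .mat, .mat', .row, .piv, .piv', .scal},
    fun k => by cases k <;> simp⟩

/-- The stack alphabets. In the matrix stacks `none` marks the end of a row. -/
abbrev Sym : Stk → Type
  | .inp | .out => Bool
  | .size | .size' => Unit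
  | .mat | .mat' => Option Parity
  | .row | .piv | .piv' | .scal => Parity

/-- The program labels. -/
inductive Lbl
  | readSize | nextRow | readRow | resetSize | dropSize
  | pivot | loadRow | flipRow | strip | stripRow | nextElim | elimRow | resetRow | dropPivot
  deriving DecidableEq

instance : Fintype Lbl :=
  ⟨{.readSize, .nextRow, .readRow, .resetSize, .dropSize, .pivot, .loadRow, .flipRow, .strip,
    .stripRow, .nextElim, .elimRow, .resetRow, .dropPivot}, fun l => by cases l <;> simp⟩

/-- The registers: a flag raised when a contradiction is found, the current scalar, and buffers
for popped symbols. -/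
structure Reg where
  bad : Bool := false
  sc : Parity := (false, false)
  bit : Option Bool := none
  tick : Option Unit := none
  sym : Option (Option Parity) := none
  ent : Option Parity := none

instance : Fintype Reg :=
  Fintype.ofEquiv (Bool × Parity × Option Bool × Option Unit × Option (Option Parity) ×
      Option Parity)
    { toFun := fun v => ⟨v.1, v.2.1, v.2.2.1, v.2.2.2.1, v.2.2.2.2.1, v.2.2.2.2.2⟩
      invFun := fun v => (v.bad, v.sc, v.bit, v.tick, v.sym, v.ent)
      left_inv := fun _ => rfl
      right_inv := fun _ => rfl }

/-- The matrix entry held in the symbol buffer. -/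
def Reg.entry (v : Reg) : Parity := v.sym.join.getD (false, false)

/-- The vector entry held in the entry buffer. -/
def Reg.vecEntry (v : Reg) : Parity := v.ent.getD (false, false)

/-- Store a popped bit. -/
def Reg.setBit (v : Reg) (x : Option Bool) : Reg := { v with bit := x }

/-- Store a popped counter symbol. -/
def Reg.setTick (v : Reg) (x : Option Unit) : Reg := { v with tick := x }

/-- Store a popped matrix symbol. -/
def Reg.setSym (v : Reg) (x : Option (Option Parity)) : Reg := { v with sym := x }

/-- Store a popped vector entry. -/
def Reg.setEnt (v : Reg) (x : Option Parity) : Reg := { v with ent := x }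

open Turing.TM2.Stmt

/-- Clear the buffers and jump to a label. -/
def jump (l : Lbl) : Turing.TM2.Stmt Sym Lbl Reg :=
  load (fun v => { bad := v.bad, sc := v.sc }) (goto fun _ => l)

/-- The program. The first five blocks translate the input, replacing every bit by its image
under `g`. The other ones repeatedly eliminate the first vertex of the matrix. -/
def program (g : Bool → Parity) : Lbl → Turing.TM2.Stmt Sym Lbl Reg
  | .readSize => pop .inp Reg.setBit <| branch (fun v => v.bit.getD false)
      (push .size (fun _ => ()) <| jump .readSize) (jump .nextRow)
  | .nextRow => peek .inp Reg.setBit <| branch (fun v => v.bit.isSome)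
      (push .mat (fun _ => none) <| jump .readRow) (jump .dropSize)
  | .readRow => pop .size Reg.setTick <| branch (fun v => v.tick.isSome)
      (push .size' (fun _ => ()) <| pop .inp Reg.setBit <|
        push .mat (fun v => some (g (v.bit.getD false))) <| jump .readRow)
      (jump .resetSize)
  | .resetSize => pop .size' Reg.setTick <| branch (fun v => v.tick.isSome)
      (push .size (fun _ => ()) <| jump .resetSize) (jump .nextRow)
  | .dropSize => pop .size Reg.setTick <| branch (fun v => v.tick.isSome)
      (jump .dropSize) (jump .pivot)
  | .pivot => pop .mat Reg.setSym <| branch (fun v => v.sym.isSome)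
      (load (fun v => { v with bad := v.bad || v.entry.2 }) <| jump .loadRow)
      (push .out (fun v => !v.bad) <| load (fun _ => {}) halt)
  | .loadRow => pop .mat Reg.setSym <| branch (fun v => v.sym.join.isSome)
      (push .piv' Reg.entry <| jump .loadRow) (jump .flipRow)
  | .flipRow => pop .piv' Reg.setEnt <| branch (fun v => v.ent.isSome)
      (push .row Reg.vecEntry <| jump .flipRow) (jump .strip)
  | .strip => pop .row Reg.setEnt <| branch (fun v => v.ent.isSome)
      (pop .mat Reg.setSym <| push .piv (fun v => v.vecEntry.join v.entry) <|
        push .scal (fun v => v.vecEntry.join v.entry) <| push .mat' (fun _ => none) <|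
        jump .stripRow)
      (jump .nextElim)
  | .stripRow => pop .mat Reg.setSym <| branch (fun v => v.sym.join.isSome)
      (push .mat' (fun v => some v.entry) <| jump .stripRow) (jump .strip)
  | .nextElim => pop .scal Reg.setEnt <| branch (fun v => v.ent.isSome)
      (load (fun v => { v with sc := v.vecEntry }) <| push .mat (fun _ => none) <|
        jump .elimRow)
      (load (fun v => { v with sc := (false, false) }) <| jump .dropPivot)
  | .elimRow => pop .mat' Reg.setSym <| branch (fun v => v.sym.join.isSome)
      (pop .piv Reg.setEnt <|
        push .mat (fun v => some (v.entry.join (v.sc.comp v.vecEntry))) <|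
        push .piv' Reg.vecEntry <| jump .elimRow)
      (jump .resetRow)
  | .resetRow => pop .piv' Reg.setEnt <| branch (fun v => v.ent.isSome)
      (push .piv Reg.vecEntry <| jump .resetRow) (jump .nextElim)
  | .dropPivot => pop .piv Reg.setEnt <| branch (fun v => v.ent.isSome)
      (jump .dropPivot) (jump .pivot)

/-- The machine. -/
def machine (g : Bool → Parity) : Turing.FinTM2 where
  K := Stk
  k₀ := .inp
  k₁ := .out
  Γ := Sym
  Λ := Lbl
  main := .readSize
  σ := Reg
  initialState := {}
  Γk₀Fin := inferInstanceAs (Fintype Bool)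
  m := program g

/-! ### Stack contents and configurations of the machine -/

/-- The contents of the stacks. -/
structure Tapes where
  inp : List Bool := []
  out : List Bool := []
  size : List Unit := []
  size' : List Unit := []
  mat : List (Option Parity) := []
  mat' : List (Option Parity) := []
  row : List Parity := []
  piv : List Parity := []
  piv' : List Parity := []
  scal : List Parity := []

/-- The stacks as a function of the index. -/
def Tapes.get (S : Tapes) : ∀ k, List (Sym k)
  | .inp => S.inp
  | .out => S.out
  | .size => S.size
  | .size' => S.size'
  | .mat => S.mat
  | .mat' => S.mat'
  | .row => S.row
  | .piv => S.piv
  | .piv' => S.piv'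
  | .scal => S.scal

section update

variable (S : Tapes)

theorem update_inp (l : List Bool) :
    Function.update S.get .inp l = Tapes.get { S with inp := l } := by
  funext k; cases k <;> rfl

theorem update_out (l : List Bool) :
    Function.update S.get .out l = Tapes.get { S with out := l } := by
  funext k; cases k <;> rfl

theorem update_size (l : List Unit) :
    Function.update S.get .size l = Tapes.get { S with size := l } := by
  funext k; cases k <;> rfl

theorem update_size' (l : List Unit) :
    Function.update S.get .size' l = Tapes.get { S with size' := l } := by
  funext k; cases k <;> rfl

theorem update_mat (l : List (Option Parity)) :
    Function.update S.get .mat l = Tapes.get { S with mat := l } := by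
  funext k; cases k <;> rfl

theorem update_mat' (l : List (Option Parity)) :
    Function.update S.get .mat' l = Tapes.get { S with mat' := l } := by
  funext k; cases k <;> rfl

theorem update_row (l : List Parity) :
    Function.update S.get .row l = Tapes.get { S with row := l } := by
  funext k; cases k <;> rfl

theorem update_piv (l : List Parity) :
    Function.update S.get .piv l = Tapes.get { S with piv := l } := by
  funext k; cases k <;> rfl

theorem update_piv' (l : List Parity) :
    Function.update S.get .piv' l = Tapes.get { S with piv' := l } := by
  funext k; cases k <;> rfl

theorem update_scal (l : List Parity) :
    Function.update S.get .scal l = Tapes.get { S with scal := l } := by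
  funext k; cases k <;> rfl

end update

/-- A configuration with empty buffers. -/
def cfg (l : Lbl) (bad : Bool) (sc : Parity) (S : Tapes) : Turing.TM2.Cfg Sym Lbl Reg :=
  ⟨some l, { bad := bad, sc := sc }, S.get⟩

/-- The machine runs between two configurations within the given time. -/
abbrev Runs (g : Bool → Parity) (T : ℕ) (c c' : Turing.TM2.Cfg Sym Lbl Reg) : Prop :=
  RunsIn (Turing.TM2.step (program g)) T c c'

variable {g : Bool → Parity} {bad : Bool} {sc : Parity}

attribute [local simp] cfg program jump update_inp update_out update_size update_size' update_mat
  update_mat' update_row update_piv update_piv' update_scal Tapes.get Reg.setBit Reg.setTick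
  Reg.setSym Reg.setEnt Reg.entry Reg.vecEntry

/-! ### The individual loops of the program -/

theorem run_readSize (n : ℕ) (l : List Bool) (u : List Unit) (S : Tapes) :
    Runs g (n + 1)
      (cfg .readSize bad sc { S with inp := List.replicate n true ++ false :: l, size := u })
      (cfg .nextRow bad sc { S with inp := l, size := List.replicate n () ++ u }) := by
  induction n generalizing u with
  | zero => exact .of_step (by simp)
  | succ n ih =>
    rw [List.replicate_succ' (n := n) (a := ()), List.append_assoc]
    refine .head ?_ (ih (() :: u))
    simp [List.replicate_succ]

theorem run_readRow (b l : List Bool) (u : List Unit) (m : List (Option Parity)) (S : Tapes) :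
    Runs g (b.length + 1)
      (cfg .readRow bad sc
        { S with inp := b ++ l, size := b.map fun _ => (), size' := u, mat := m })
      (cfg .resetSize bad sc { S with
        inp := l, size := [], size' := (b.map fun _ => ()).reverseAux u
        mat := (b.map fun x => some (g x)).reverseAux m }) := by
  induction b generalizing u m with
  | nil => exact .of_step (by simp)
  | cons x b ih =>
    refine .head ?_ (ih (() :: u) (some (g x) :: m))
    simp

theorem run_resetSize (u w : List Unit) (S : Tapes) :
    Runs g (u.length + 1)
      (cfg .resetSize bad sc { S with size' := u, size := w })
      (cfg .nextRow bad sc { S with size' := [], size := u.reverseAux w }) := by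
  induction u generalizing w with
  | nil => exact .of_step (by simp)
  | cons x u ih =>
    refine .head ?_ (ih (() :: w))
    simp

theorem run_dropSize (u : List Unit) (S : Tapes) :
    Runs g (u.length + 1)
      (cfg .dropSize bad sc { S with size := u }) (cfg .pivot bad sc { S with size := [] }) := by
  induction u with
  | nil => exact .of_step (by simp)
  | cons x u ih =>
    refine .head ?_ ih
    simp

theorem run_loadRow (l : List Parity) (m : List (Option Parity)) (y : List Parity) (S : Tapes) :
    Runs g (l.length + 1)
      (cfg .loadRow bad sc { S with mat := l.map some ++ none :: m, piv' := y })
      (cfg .flipRow bad sc { S with mat := m, piv' := l.reverseAux y }) := by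
  induction l generalizing y with
  | nil => exact .of_step (by simp)
  | cons x l ih =>
    refine .head ?_ (ih (x :: y))
    simp

theorem run_flipRow (l y : List Parity) (S : Tapes) :
    Runs g (l.length + 1)
      (cfg .flipRow bad sc { S with piv' := l, row := y })
      (cfg .strip bad sc { S with piv' := [], row := l.reverseAux y }) := by
  induction l generalizing y with
  | nil => exact .of_step (by simp)
  | cons x l ih =>
    refine .head ?_ (ih (x :: y))
    simp

theorem run_stripRow (l : List Parity) (m y : List (Option Parity)) (S : Tapes) :
    Runs g (l.length + 1)
      (cfg .stripRow bad sc { S with mat := l.map some ++ none :: m, mat' := y })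
      (cfg .strip bad sc { S with mat := m, mat' := (l.map some).reverseAux y }) := by
  induction l generalizing y with
  | nil => exact .of_step (by simp)
  | cons x l ih =>
    refine .head ?_ (ih (some x :: y))
    simp

/-- Row and pivot vector form one list of pairs so that they run out together. The vector is saved
on `piv'`, from which `run_resetRow` restores it for the next row. -/
theorem run_elimRow (zs : List (Parity × Parity)) (m m' : List (Option Parity)) (y : List Parity)
    (S : Tapes) :
    Runs g (zs.length + 1)
      (cfg .elimRow bad sc { S with
        mat := m, mat' := zs.map (fun z => some z.1) ++ none :: m'
        piv := zs.map Prod.snd, piv' := y })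
      (cfg .resetRow bad sc { S with
        mat := (zs.map fun z => some (z.1.join (sc.comp z.2))).reverseAux m, mat' := m'
        piv := [], piv' := (zs.map Prod.snd).reverseAux y }) := by
  induction zs generalizing y m with
  | nil => exact .of_step (by simp)
  | cons z zs ih =>
    refine .head ?_ (ih (some (z.1.join (sc.comp z.2)) :: m) (z.2 :: y))
    simp

theorem run_resetRow (l y : List Parity) (S : Tapes) :
    Runs g (l.length + 1)
      (cfg .resetRow bad sc { S with piv' := l, piv := y })
      (cfg .nextElim bad sc { S with piv' := [], piv := l.reverseAux y }) := by
  induction l generalizing y with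
  | nil => exact .of_step (by simp)
  | cons x l ih =>
    refine .head ?_ (ih (x :: y))
    simp

theorem run_dropPivot (l : List Parity) (S : Tapes) :
    Runs g (l.length + 1)
      (cfg .dropPivot bad sc { S with piv := l }) (cfg .pivot bad sc { S with piv := [] }) := by
  induction l with
  | nil => exact .of_step (by simp)
  | cons x l ih =>
    refine .head ?_ ih
    simp

/-! ### Matrices on stacks and one round of elimination -/

/-- The rows of a matrix written one after the other, each followed by an end marker. -/
def flat (rows : List (List Parity)) : List (Option Parity) :=
  rows.flatMap fun r => r.map some ++ [none]

/-- The rows of a matrix written one after the other, each preceded by a marker. -/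
def flat' (rows : List (List Parity)) : List (Option Parity) :=
  rows.flatMap fun r => none :: r.map some

theorem flat_cons (r : List Parity) (rows : List (List Parity)) :
    flat (r :: rows) = r.map some ++ none :: flat rows := by simp [flat]

theorem flat'_cons (r : List Parity) (rows : List (List Parity)) :
    flat' (r :: rows) = none :: r.map some ++ flat' rows := by simp [flat']

/-- Every pass pushes the marker before the entries of a row. Read from the top of the stack, the
marker then ends the row, and both the rows and their entries come in reverse order. -/
theorem reverse_flat' (rows : List (List Parity)) :
    (flat' rows).reverse = flat (rows.map List.reverse).reverse := by
  induction rows with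
  | nil => rfl
  | cons r rows ih => simp [flat'_cons, ih, flat]

/-- A row costs one step to announce it and `n + 1` steps each to read it and to restore the
counter. The end is recognised by an empty input stack, so rows of length zero would go unnoticed;
hence `0 < n`. -/
theorem run_nextRow (n : ℕ) (rows : List (List Bool)) (hn : 0 < n) (h : ∀ b ∈ rows, b.length = n)
    (m : List (Option Parity)) (S : Tapes) :
    Runs g (rows.length * (2 * n + 3) + 1)
      (cfg .nextRow bad sc { S with
        inp := rows.flatten, size := List.replicate n (), size' := [], mat := m })
      (cfg .dropSize bad sc { S with
        inp := [], size := List.replicate n (), size' := []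
        mat := (flat' (rows.map (List.map g))).reverse ++ m }) := by
  induction rows generalizing m with
  | nil => exact (RunsIn.of_step (by simp [flat'])).mono (by simp)
  | cons b rows ih =>
    have hb : b.length = n := h b (by simp)
    have hu : List.replicate n () = b.map fun _ => () := by simp [hb]
    have h1 := run_readRow (g := g) (bad := bad) (sc := sc) b rows.flatten [] (none :: m) S
    have h2 := run_resetSize (g := g) (bad := bad) (sc := sc) ((b.map fun _ => ()).reverse) []
      { S with inp := rows.flatten, mat := (b.map fun x => some (g x)).reverseAux (none :: m) }
    have h3 := ih (fun b hb => h b (by simp [hb]))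
      ((b.map fun x => some (g x)).reverseAux (none :: m))
    simp only [List.reverseAux_eq, List.append_nil, List.reverse_reverse] at h1 h2 h3
    rw [hu] at h3 ⊢
    have h4 := (h1.trans h2).trans h3
    refine RunsIn.head_of_eq ?_ h4 ?_ ?_
    · rcases b with _ | ⟨x, b⟩
      · simp at hb; omega
      · simp
    · simp [flat'_cons, Function.comp_def]
    · simp [hb]; ring_nf; omega

/-- A triple in `ps` holds the pivot row's entry for a vertex, the first entry of that vertex's own
row, and the rest of that row. The join of the first two is stored twice: on `piv` as a vector
reused for every row, on `scal` as a queue of multipliers used once each. -/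
theorem run_strip (k : ℕ) (ps : List (Parity × Parity × List Parity))
    (h : ∀ p ∈ ps, p.2.2.length = k) (y z : List Parity) (w : List (Option Parity)) (S : Tapes) :
    Runs g (ps.length * (k + 2) + 1)
      (cfg .strip bad sc { S with
        row := ps.map fun p => p.1, mat := flat (ps.map fun p => p.2.1 :: p.2.2)
        piv := y, scal := z, mat' := w })
      (cfg .nextElim bad sc { S with
        row := [], mat := []
        piv := (ps.map fun p => p.1.join p.2.1).reverse ++ y
        scal := (ps.map fun p => p.1.join p.2.1).reverse ++ z
        mat' := (flat' (ps.map fun p => p.2.2)).reverse ++ w }) := by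
  induction ps generalizing y z w with
  | nil => exact (RunsIn.of_step (by simp [flat, flat'])).mono (by simp)
  | cons p ps ih =>
    have h1 := run_stripRow (g := g) (bad := bad) (sc := sc) p.2.2
      (flat (ps.map fun p => p.2.1 :: p.2.2)) (none :: w)
      { S with
        row := ps.map fun p => p.1
        piv := p.1.join p.2.1 :: y, scal := p.1.join p.2.1 :: z }
    have h2 := ih (fun q hq => h q (by simp [hq])) (p.1.join p.2.1 :: y) (p.1.join p.2.1 :: z)
      ((p.2.2.map some).reverseAux (none :: w))
    have hp : p.2.2.length = k := h p (by simp)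
    refine RunsIn.head_of_eq ?_ (h1.trans h2) ?_ ?_
    · simp [flat_cons]
    · simp [flat'_cons, List.reverseAux_eq]
    · simp [hp]; ring_nf; omega

/-- The initial `sc` is arbitrary because each round leaves its own multiplier in the register. A
row costs one step to load the multiplier and `v.length + 1` steps each to update the row and to
restore the vector. -/
theorem run_nextElim (v : List Parity) (qs : List (Parity × List Parity))
    (h : ∀ q ∈ qs, q.2.length = v.length) (m : List (Option Parity)) (sc : Parity) (S : Tapes) :
    Runs g (qs.length * (2 * v.length + 3) + 1)
      (cfg .nextElim bad sc { S with
        scal := qs.map fun q => q.1, mat' := flat (qs.map fun q => q.2), piv := v, piv' := []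
        mat := m })
      (cfg .dropPivot bad (false, false) { S with
        scal := [], mat' := [], piv := v, piv' := []
        mat := (flat' (qs.map fun q =>
          List.zipWith (fun e t => e.join (q.1.comp t)) q.2 v)).reverse ++ m }) := by
  induction qs generalizing m sc with
  | nil => exact (RunsIn.of_step (by simp [flat, flat'])).mono (by simp)
  | cons q qs ih =>
    have hq : q.2.length = v.length := h q (by simp)
    have h1 := run_elimRow (g := g) (bad := bad) (sc := q.1) (q.2.zip v) (none :: m)
      (flat (qs.map fun q => q.2)) [] { S with scal := qs.map fun q => q.1 }
    have h2 := run_resetRow (g := g) (bad := bad) (sc := q.1) v.reverse []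
      { S with
        scal := qs.map fun q => q.1, mat' := flat (qs.map fun q => q.2)
        mat := ((q.2.zip v).map fun z => some (z.1.join (q.1.comp z.2))).reverseAux (none :: m) }
    have h3 := ih (fun q hq => h q (by simp [hq]))
      (((q.2.zip v).map fun z => some (z.1.join (q.1.comp z.2))).reverseAux (none :: m)) q.1
    have e1 : (q.2.zip v).map Prod.snd = v := List.map_snd_zip (by omega)
    have e2 : (q.2.zip v).map (fun z => some z.1) = q.2.map some := by
      rw [← Function.comp_def some Prod.fst, ← List.map_map, List.map_fst_zip (by omega)]
    rw [e1, e2] at h1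
    simp only [List.reverseAux_eq, List.append_nil, List.reverse_reverse] at h1 h2 h3
    refine RunsIn.head_of_eq ?_ ((h1.trans h2).trans h3) ?_ ?_
    · simp [flat_cons]
    · simp [flat'_cons, List.map_zip_eq_zipWith]; rfl
    · simp [hq]; ring_nf; omega

/-- The rows of a matrix. -/
def rowsOf {n : ℕ} (M : Fin n → Fin n → Parity) : List (List Parity) :=
  List.ofFn fun i => List.ofFn (M i)

/-- The stages add up to `3 * k ^ 2 + 8 * k + 6` steps, which meets the bound with equality at `k =
0`. -/
theorem run_eliminate {k : ℕ} (M : Fin (k + 1) → Fin (k + 1) → Parity) :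
    Runs g (6 * (k + 1) ^ 2)
      (cfg .pivot bad (false, false) { mat := flat (rowsOf M) })
      (cfg .pivot (bad || (M 0 0).2) (false, false) { mat := flat (rowsOf (eliminate M)) }) := by
  set bad' := bad || (M 0 0).2
  set P := List.ofFn (pivotRow M) with hP
  let ps : List (Parity × Parity × List Parity) :=
    List.ofFn fun i : Fin k => (M 0 i.succ, M i.succ 0, List.ofFn fun j : Fin k => M i.succ j.succ)
  -- Stripping reverses the rows and their entries, and the elimination pass reverses them again.
  -- Hence `qs` and the pivot vector are reversed here, while the final matrix is in the original
  -- order.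
  let qs : List (Parity × List Parity) :=
    (List.ofFn fun i : Fin k =>
      (pivotRow M i, (List.ofFn fun j : Fin k => M i.succ j.succ).reverse)).reverse
  have h1 := run_loadRow (g := g) (bad := bad') (sc := (false, false))
    (List.ofFn fun j : Fin k => M 0 j.succ) (flat (ps.map fun p => p.2.1 :: p.2.2)) [] {}
  have h2 := run_flipRow (g := g) (bad := bad') (sc := (false, false))
    (List.ofFn fun j : Fin k => M 0 j.succ).reverse []
    { mat := flat (ps.map fun p => p.2.1 :: p.2.2) }
  have h3 := run_strip (g := g) (bad := bad') (sc := (false, false)) k ps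
    (by intro p hp; obtain ⟨i, rfl⟩ := (List.mem_ofFn' _ _).1 hp; simp) [] [] [] {}
  have h4 := run_nextElim (g := g) (bad := bad') P.reverse qs
    (by
      intro q hq
      obtain ⟨i, rfl⟩ := (List.mem_ofFn' _ _).1 (List.mem_reverse.1 hq)
      simp [hP]) [] (false, false) {}
  have h5 := run_dropPivot (g := g) (bad := bad') (sc := (false, false)) P.reverse
    { mat := flat (rowsOf (eliminate M)) }
  have e1 : (ps.map fun p => p.1) = List.ofFn fun j : Fin k => M 0 j.succ := by
    simp [ps, List.map_ofFn, Function.comp_def]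
  have e2 : (ps.map fun p => p.1.join p.2.1) = P := by
    simp only [ps, hP, List.map_ofFn]; rfl
  have e3 : (flat' (ps.map fun p => p.2.2)).reverse = flat (qs.map fun q => q.2) := by
    rw [reverse_flat']
    simp [ps, qs, List.map_ofFn, Function.comp_def]
  have e4 : (qs.map fun q => q.1) = P.reverse := by
    simp only [qs, hP, List.map_reverse, List.map_ofFn]; rfl
  have e5 : (flat' (qs.map fun q =>
      List.zipWith (fun e t => e.join (q.1.comp t)) q.2 P.reverse)).reverse
      = flat (rowsOf (eliminate M)) := by
    rw [reverse_flat']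
    congr 1
    simp only [qs, List.map_reverse, List.reverse_reverse, List.map_ofFn, rowsOf]
    congr 1
    funext i
    simp only [Function.comp_def]
    rw [← List.reverse_zipWith (by simp [hP]), List.reverse_reverse]
    apply List.ext_getElem <;> simp [hP, eliminate]
  have e6 : flat (rowsOf M) = some (M 0 0) ::
      ((List.ofFn fun j : Fin k => M 0 j.succ).map some ++
        none :: flat (ps.map fun p => p.2.1 :: p.2.2)) := by
    simp [rowsOf, List.ofFn_succ, flat_cons, ps, List.map_ofFn, Function.comp_def]
  simp only [List.reverseAux_eq, List.append_nil, List.reverse_reverse] at h1 h2 h3 h4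
  rw [e1, e2, e3] at h3
  rw [e4, e5] at h4
  refine RunsIn.head_of_eq ?_ ((((h1.trans h2).trans h3).trans h4).trans h5) rfl ?_
  · rw [e6]
    simp [cfg, program, jump, update_mat, Tapes.get, Reg.setSym, Reg.entry, bad']
  · simp [ps, qs, hP]
    ring_nf
    nlinarith

/-- Induction on the number of vertices: the flag collects the diagonal conditions met on the way,
and the empty matrix is satisfiable. The time bound holds since `(n + 1) ^ 2 + n ^ 3 ≤ (n + 1) ^ 3`.
-/
theorem run_solve {n : ℕ} (M : Fin n → Fin n → Parity) :
    Runs g (6 * n ^ 3 + 1) (cfg .pivot bad (false, false) { mat := flat (rowsOf M) })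
      ⟨none, {}, Tapes.get { out := [!bad && @decide (Satisfiable M) (Classical.dec _)] }⟩ := by
  classical
  induction n generalizing bad with
  | zero =>
    refine (RunsIn.of_step ?_).mono (by simp)
    have : Satisfiable M := ⟨fun _ => true, fun i => i.elim0⟩
    simp [cfg, program, update_mat, update_out, Tapes.get, Reg.setSym, rowsOf, flat, this]
  | succ n ih =>
    refine ((run_eliminate M).trans (ih (eliminate M))).of_eq ?_ ?_
    · have : (!(bad || (M 0 0).2) && decide (Satisfiable (eliminate M))) =
          (!bad && decide (Satisfiable M)) := by
        cases bad <;> cases h : (M 0 0).2 <;> simp [h, satisfiable_iff_eliminate M]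
      rw [this]
    · ring_nf; nlinarith

/-! ### From the encoded input to the output bit -/

open Classical in
theorem encode_eq {n : ℕ} (B : Digraph (Fin n)) :
    encode B = List.replicate n true ++
      false :: (List.ofFn fun i => List.ofFn fun j => decide (B.Adj i j)).flatten := rfl

open Classical in
theorem run_encode {n : ℕ} (B : Digraph (Fin n)) :
    Runs g (20 * (n + 1) ^ 3) (cfg .readSize false (false, false) { inp := encode B })
      ⟨none, {}, Tapes.get { out := [decide (Satisfiable fun i j => g (decide (B.Adj i j)))] }⟩ := by
  -- Reading the input onto a stack reverses both indices; satisfiability is invariant under this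
  -- relabelling.
  let M : Fin n → Fin n → Parity := fun i j => g (decide (B.Adj i.rev j.rev))
  let rows := List.ofFn fun i => List.ofFn fun j => decide (B.Adj i j)
  have h1 := run_readSize (g := g) (bad := false) (sc := (false, false)) n rows.flatten [] {}
  have h2 : Runs g (n * (2 * n + 3) + 1)
      (cfg .nextRow false (false, false) { inp := rows.flatten, size := List.replicate n () })
      (cfg .dropSize false (false, false)
        { size := List.replicate n (), mat := (flat' (rows.map (List.map g))).reverse }) := by
    -- For `n = 0` nothing follows the separator, and the row loop exits at once.
    rcases Nat.eq_zero_or_pos n with rfl | hn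
    · refine (RunsIn.of_step ?_).mono (by simp)
      simp [cfg, program, jump, Tapes.get, Reg.setBit, rows, flat']
    · have := run_nextRow (g := g) (bad := false) (sc := (false, false)) n rows hn
        (by intro b hb; obtain ⟨i, rfl⟩ := (List.mem_ofFn' _ _).1 hb; simp) [] {}
      simpa [rows] using this
  have h3 := run_dropSize (g := g) (bad := false) (sc := (false, false)) (List.replicate n ())
    { mat := (flat' (rows.map (List.map g))).reverse }
  have e : (flat' (rows.map (List.map g))).reverse = flat (rowsOf M) := by
    rw [reverse_flat']
    congr 1
    apply List.ext_getElem
    · simp [rows, rowsOf]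
    · intro i hi hi'
      simp only [rows, rowsOf, List.map_ofFn, List.getElem_reverse, List.getElem_ofFn,
        Function.comp_apply]
      apply List.ext_getElem
      · simp
      · intro j hj hj'
        simp [M, Fin.rev, Nat.sub_sub, Nat.add_comm]
  have h4 := run_solve (g := g) (bad := false) M
  have hM : Satisfiable M ↔ Satisfiable fun i j => g (decide (B.Adj i j)) := by
    constructor
    · rintro ⟨c, hc⟩
      exact ⟨fun i => c i.rev, fun i j => by simpa [M] using hc i.rev j.rev⟩
    · rintro ⟨c, hc⟩
      exact ⟨fun i => c i.rev, fun i j => hc i.rev j.rev⟩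
  rw [e] at h2 h3
  have hM' : decide (Satisfiable M) = decide (Satisfiable fun i j => g (decide (B.Adj i j))) :=
    decide_eq_decide.2 hM
  rw [hM'] at h4
  simp only [List.append_nil] at h1
  have h5 := ((h1.trans h2).trans h3).trans h4
  rw [← encode_eq] at h5
  refine h5.of_eq (by simp) ?_
  simp only [List.length_replicate]
  ring_nf
  nlinarith

/-- The machine with its alphabets. -/
def computer (g : Bool → Parity) : Turing.TM2ComputableAux Bool Bool where
  tm := machine g
  inputAlphabet := Equiv.refl Bool
  outputAlphabet := Equiv.refl Bool

open Classical in
theorem outputsWithin_computer {n : ℕ} (B : Digraph (Fin n)) :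
    OutputsWithin (computer g) (encode B)
      (decide (Satisfiable fun i j => g (decide (B.Adj i j))))
      ((20 * (Polynomial.X + 1) ^ 3 : Polynomial ℕ).eval (encode B).length) := by
  -- The unary prefix turns a bound in the number of vertices into one in the input length.
  have hn : n ≤ (encode B).length := by simp [encode]
  have h := (run_encode (g := g) B).mono (T' :=
    ((20 * (Polynomial.X + 1) ^ 3 : Polynomial ℕ).eval (encode B).length)) (by
      simp only [Polynomial.eval_mul, Polynomial.eval_pow, Polynomial.eval_add, Polynomial.eval_X,
        Polynomial.eval_one, Polynomial.eval_ofNat]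
      gcongr)
  have e1 : Turing.initList (machine g) (encode B) =
      cfg .readSize false (false, false) { inp := encode B } := by
    simp only [Turing.initList, cfg]
    congr 1
    funext k
    cases k <;> rfl
  have e2 : ∀ b, Turing.haltList (machine g) [b] = ⟨none, {}, Tapes.get { out := [b] }⟩ := by
    intro b
    simp only [Turing.haltList]
    congr 1
    funext k
    cases k <;> rfl
  have e3 : (encode B).map (computer g).inputAlphabet.symm = encode B := List.map_id _
  rw [← (congrArg (Turing.initList (machine g)) e3).trans e1] at h
  exact h.of_eq (e2 _).symm le_rfl

end Solver

open Classical in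
/-- If the yes instances satisfy, and the no instances violate, a system of parity constraints
read off from the adjacency matrix, then the promise problem is in P. -/
theorem entangledCSP_mem_classP {V : Type*} [Fintype V] (w : Model) (A : Digraph V) (c s : ℝ)
    (hs : s ≤ c) (g : Bool → Parity)
    (hyes : ∀ (n : ℕ) (B : Digraph (Fin n)), (∃ r ∈ defects w B A, r ≤ 1 - c) →
      Satisfiable fun i j => g (decide (B.Adj i j)))
    (hno : ∀ (n : ℕ) (B : Digraph (Fin n)), (∀ r ∈ defects w B A, 1 - s < r) →
      ¬ Satisfiable fun i j => g (decide (B.Adj i j))) :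
    entangledCSP w A c s hs ∈ classP := by
  refine ⟨Solver.computer g, 20 * (Polynomial.X + 1) ^ 3, ?_, ?_⟩
  · rintro x ⟨n, B, rfl, h⟩
    simpa [hyes n B h] using Solver.outputsWithin_computer (g := g) B
  · rintro x ⟨n, B, rfl, h⟩
    simpa [hno n B h] using Solver.outputsWithin_computer (g := g) B

/-! ### Projection-valued measures in a ring -/

/-- A finite family of orthogonal idempotents with sum `1`. -/
structure IsPVM {α R : Type*} [Fintype α] [Ring R] (p : α → R) : Prop where
  idem : ∀ a, p a * p a = p a
  orth : ∀ a b, a ≠ b → p a * p b = 0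
  sum_eq : ∑ a, p a = 1

theorem IsPVM.map {α R R' : Type*} [Fintype α] [Ring R] [Ring R'] {p : α → R} (hp : IsPVM p)
    (f : R →+* R') : IsPVM fun a => f (p a) where
  idem a := by rw [← map_mul, hp.idem]
  orth a b h := by rw [← map_mul, hp.orth a b h, map_zero]
  sum_eq := by rw [← map_sum, hp.sum_eq, map_one]

theorem isPVM_gen {Q : Type*} {Ans : Q → Type*} [∀ q, Fintype (Ans q)] (q : Q) :
    IsPVM fun a : Ans q => gen q a where
  idem a := (RingCon.eq _).2 (RingConGen.Rel.of _ _ (PVMRel.idem q a))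
  orth a b h := (RingCon.eq _).2 (RingConGen.Rel.of _ _ (PVMRel.orth q a b h))
  sum_eq := by
    have h : (RingCon.mk' (ringConGen (PVMRel Q Ans)))
        (∑ a : Ans q, letter (X := Σ q, Ans q) ⟨q, a⟩) = RingCon.mk' _ 1 :=
      (RingCon.eq _).2 (RingConGen.Rel.of _ _ (PVMRel.sum q))
    rw [map_sum, map_one] at h
    exact h

/-- The sum of the members of a family with a given property. -/
def event {α R : Type*} [Fintype α] [Ring R] (p : α → R) (S : α → Bool) : R :=
  ∑ a, if S a then p a else 0

namespace IsPVM

variable {α R : Type*} [Fintype α] [Ring R] {p : α → R}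

theorem mul_event (hp : IsPVM p) (S : α → Bool) (a : α) :
    p a * event p S = if S a then p a else 0 := by
  rw [event, Finset.mul_sum, Finset.sum_eq_single a]
  · split_ifs <;> simp [hp.idem]
  · intro b _ h
    split_ifs <;> simp [hp.orth a b h.symm]
  · simp

end IsPVM

theorem event_add_not {α R : Type*} [Fintype α] [Ring R] {p : α → R} (hp : ∑ a, p a = 1)
    (S : α → Bool) : event p S + event p (fun a => !S a) = 1 := by
  rw [event, event, ← Finset.sum_add_distrib, ← hp]
  refine Finset.sum_congr rfl fun a _ => ?_
  cases S a <;> simp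

theorem event_not {α R : Type*} [Fintype α] [Ring R] {p : α → R} (hp : ∑ a, p a = 1)
    (S : α → Bool) : event p (fun a => !S a) = 1 - event p S :=
  eq_sub_of_add_eq' (event_add_not hp S)

theorem event_mul_event_eq_zero {α β R : Type*} [Fintype α] [Fintype β] [Ring R] {p : α → R}
    {p' : β → R} {S : α → Bool} {S' : β → Bool}
    (h : ∀ a b, S a = true → S' b = true → p a * p' b = 0) : event p S * event p' S' = 0 := by
  rw [event, event, Finset.sum_mul_sum]
  refine Finset.sum_eq_zero fun a _ => Finset.sum_eq_zero fun b _ => ?_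
  split_ifs with h1 h2 <;> simp [*]

/-- Complementary idempotents along the edges of a digraph yield a two-colouring. -/
theorem exists_coloring_of_idempotents {W R : Type*} [Ring R] [Nontrivial R] (H : Digraph W)
    (q : W → R) (hmul : ∀ x y, H.Adj x y → q x * q y = 0)
    (hadd : ∀ x y, H.Adj x y → q x + q y = 1) :
    ∃ c : W → Bool, ∀ x y, H.Adj x y → c x ≠ c y := by
  classical
  -- The order has nothing to do with the ring structure. It only singles out one element of each
  -- pair `{q x, 1 - q x}`, and moving along an edge swaps the two.
  let _ : LinearOrder R := linearOrderOfSTO (WellOrderingRel (α := R))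
  refine ⟨fun x => decide (q x < 1 - q x), fun x y hxy => ?_⟩
  have e : q y = 1 - q x := eq_sub_of_add_eq' (hadd x y hxy)
  -- If `q x` were its own complement, then `q x = q y`, so both `q x * q x` and `q x * (1 - q x)`
  -- would be `q x * q y = 0`. Their sum is `q x`.
  have hne : q x ≠ 1 - q x := by
    intro h0
    have h1 : q x * q x = 0 := by rw [← hmul x y hxy, e, ← h0]
    have h2 : q x * (1 - q x) = 0 := by rw [← e, hmul x y hxy]
    have h3 : q x = 0 := by rwa [mul_sub, mul_one, h1, sub_zero] at h2
    rw [h3, sub_zero] at h0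
    exact zero_ne_one h0
  simp only [e, sub_sub_cancel]
  rcases lt_or_gt_of_ne hne with h1 | h1
  · simp [h1, h1.le]
  · simp [h1, h1.le]

/-! ### The quotient by the null ideal of a trace -/

section Null

variable {A : Type*} [Ring A] [StarRing A] [Algebra ℂ A] {τ : A →ₗ[ℂ] ℂ}

/-- The degenerate case of Cauchy–Schwarz: `τ (star (w + z • x) * (w + z • x))` has no quadratic
term in `z`, and a real-affine function that stays nonnegative is constant. That `b'` is the
conjugate of `b` is not presupposed, so `z = 1` and `z = I` are both needed to separate them. -/
theorem IsTracialState.map_mul_eq_zero [StarModule ℂ A] (hτ : IsTracialState τ) {x : A}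
    (hx : τ (star x * x) = 0) (y : A) : τ (y * x) = 0 := by
  obtain ⟨w, rfl⟩ := star_involutive.surjective y
  set a := τ (star w * w)
  set b := τ (star w * x)
  set b' := τ (star x * w)
  have ha : a.im = 0 := hτ.im_zero w
  have key : ∀ z : ℂ, τ (star (w + z • x) * (w + z • x)) = a + (z * b + star z * b') := by
    intro z
    have : star (w + z • x) * (w + z • x) = star w * w + (z • (star w * x) +
        star z • (star x * w)) + (star z * z) • (star x * x) := by
      simp only [star_add, star_smul, add_mul, mul_add, smul_mul_assoc, mul_smul_comm, smul_add,
        smul_smul, mul_comm z]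
      abel
    rw [this]
    simp [hx, a, b, b']
  have hre : ∀ z : ℂ, (z * b + star z * b').re = 0 := by
    intro z
    by_contra hne
    set t := (z * b + star z * b').re with ht
    -- The scaling is chosen so that the real part becomes `a.re - (a.re + 1) = -1`.
    have h1 := hτ.re_nonneg (w + (((-(a.re + 1) / t : ℝ) : ℂ) * z) • x)
    rw [key] at h1
    have h2 : (((-(a.re + 1) / t : ℝ) : ℂ) * z * b + star (((-(a.re + 1) / t : ℝ) : ℂ) * z) * b')
        = ((-(a.re + 1) / t : ℝ) : ℂ) * (z * b + star z * b') := by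
      simp only [star_mul', Complex.star_def, Complex.conj_ofReal]
      ring
    rw [h2, Complex.add_re, Complex.re_ofReal_mul, ← ht, div_mul_cancel₀ _ hne] at h1
    linarith
  have him : ∀ z : ℂ, (z * b + star z * b').im = 0 := by
    intro z
    have h1 := hτ.im_zero (w + z • x)
    rw [key, Complex.add_im, ha, zero_add] at h1
    exact h1
  have h0 : ∀ z : ℂ, z * b + star z * b' = 0 := fun z => Complex.ext (hre z) (him z)
  have h1 := h0 1
  have h2 := h0 Complex.I
  simp only [one_mul, star_one, Complex.star_def, Complex.conj_I] at h1 h2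
  have h3 : Complex.I * (2 * b) = 0 := by linear_combination h2 + Complex.I * h1
  simpa using h3

/-- Elements are identified if a trace does not distinguish their multiples. -/
def traceCon (hτ : IsTracialState τ) : RingCon A where
  r x y := ∀ z, τ (z * x) = τ (z * y)
  iseqv := ⟨fun _ _ => rfl, fun h z => (h z).symm, fun h h' z => (h z).trans (h' z)⟩
  add' h h' z := by simp only [mul_add, map_add, h z, h' z]
  -- The relation tests right factors only; traciality cycles a left factor into that position,
  -- which makes the null ideal two-sided.
  mul' {w x y z} h h' u := by
    rw [← mul_assoc, h', hτ.tracial, ← mul_assoc, h, mul_assoc, hτ.tracial, mul_assoc]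

theorem nontrivial_traceCon (hτ : IsTracialState τ) : Nontrivial (traceCon hτ).Quotient := by
  refine ⟨1, 0, fun h => ?_⟩
  have h1 : traceCon hτ 1 0 := (RingCon.eq _).1 h
  have h2 : τ (1 * 1) = τ (1 * 0) := h1 1
  simp [hτ.map_one] at h2

/-- A trace with vanishing defect yields a nonzero ring in which the penalised elements
vanish. -/
theorem exists_ringHom_of_defect_nonpos [StarModule ℂ A] {ι : Type*} [Fintype ι] {μ : ι → ℝ}
    {x : ι → A} (hμ : ∀ i, 0 ≤ μ i) {r : ℝ} (hr : r ∈ connesValues (defectPoly μ x))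
    (hr0 : r ≤ 0) :
    ∃ c : RingCon A, Nontrivial c.Quotient ∧ ∀ i, 0 < μ i → c.mk' (x i) = 0 := by
  obtain ⟨τ, hτ, -, rfl⟩ := hr
  refine ⟨traceCon hτ, nontrivial_traceCon hτ, fun i hi => ?_⟩
  have h1 : (τ (defectPoly μ x)).re = ∑ i, μ i * (τ (star (x i) * x i)).re := by
    simp [defectPoly]
  rw [h1] at hr0
  have hnn : ∀ j ∈ Finset.univ, 0 ≤ μ j * (τ (star (x j) * x j)).re := fun j _ =>
    mul_nonneg (hμ j) (hτ.re_nonneg _)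
  have h2 := (Finset.sum_eq_zero_iff_of_nonneg hnn).1
    (le_antisymm hr0 (Finset.sum_nonneg hnn)) i (Finset.mem_univ i)
  have h3 : τ (star (x i) * x i) = 0 :=
    Complex.ext ((mul_eq_zero.1 h2).resolve_left hi.ne') (hτ.im_zero _)
  refine (RingCon.eq _).2 fun z => ?_
  rw [hτ.map_mul_eq_zero h3, mul_zero, map_zero]

end Null

/-! ### Characters of the PVM algebra -/

section Character

variable {Q : Type*} {Ans : Q → Type*} (s : ∀ q, Ans q)

open Classical in
/-- The character of the free algebra given by a deterministic choice of answers. -/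
noncomputable def freeCharacter : FreeStarAlgebra (Σ q, Ans q) →ₐ[ℂ] ℂ :=
  MonoidAlgebra.lift ℂ ℂ (FreeMonoid (Σ q, Ans q))
    (FreeMonoid.lift fun k => if k.2 = s k.1 then 1 else 0)

open Classical in
theorem freeCharacter_letter (k : Σ q, Ans q) :
    freeCharacter s (letter k) = if k.2 = s k.1 then 1 else 0 := by
  simp [freeCharacter, letter]

/-- Letters take the real values `0` and `1`, and reversing a word does not change its value in the
commutative ring `ℂ`. -/
theorem freeCharacter_star (x : FreeStarAlgebra (Σ q, Ans q)) :
    freeCharacter s (star x) = star (freeCharacter s x) := by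
  classical
  change freeCharacter s (freeStar _ x) = _
  induction x using MonoidAlgebra.induction_linear with
  | zero => simp
  | add x y hx hy => rw [map_add, map_add, hx, hy, map_add, star_add]
  | single m z =>
    rw [freeStar_single]
    simp only [freeCharacter, MonoidAlgebra.lift_single, smul_eq_mul, star_mul']
    congr 1
    induction m using FreeMonoid.inductionOn with
    | one => simp
    | of k => simp only [FreeMonoid.star_of, FreeMonoid.lift_eval_of]; split_ifs <;> simp
    | mul a b ha hb => rw [star_mul, map_mul, map_mul, ha, hb, star_mul']; ring

variable [∀ q, Fintype (Ans q)]

theorem ringConGen_le_ker_freeCharacter :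
    ringConGen (PVMRel Q Ans) ≤ RingCon.ker (freeCharacter s).toRingHom := by
  classical
  refine RingCon.ringConGen_le.2 ?_
  intro x y h
  change freeCharacter s x = freeCharacter s y
  cases h with
  | idem q a => simp [freeCharacter_letter]
  | orth q a b h =>
    simp only [map_mul, freeCharacter_letter, map_zero]
    split_ifs with h1 h2 <;> simp_all
  | sum q => simp [map_sum, freeCharacter_letter]

/-- The character of the PVM algebra given by a deterministic choice of answers. -/
noncomputable def character : PVMAlgebra Q Ans →⋆ₐ[ℂ] ℂ where
  toAlgHom := RingCon.liftₐ _ (freeCharacter s) (ringConGen_le_ker_freeCharacter s)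
  map_star' := by
    rintro ⟨x⟩
    exact freeCharacter_star s x

open Classical in
theorem character_gen (q : Q) (a : Ans q) :
    character s (gen q a) = if a = s q then 1 else 0 :=
  freeCharacter_letter s ⟨q, a⟩

end Character

/-- The constant sequence `z` represents the scalar. This makes every character Connes-embeddable,
through the scalars of `UltraR`. -/
theorem hasUltraTrace_algebraMap (z : ℂ) : HasUltraTrace (algebraMap ℂ UltraR z) z := by
  refine ⟨algebraMap ℂ BddSeqR z, rfl, ?_⟩
  have h : groupTrace (algebraMap ℂ (Ell2 FinPerm →L[ℂ] Ell2 FinPerm) z) = z := by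
    classical
    rw [groupTrace, delta_inner, Algebra.algebraMap_eq_smul_one]
    simp [delta, lp.single_apply]
  exact tendsto_const_nhds.congr fun _ => h.symm

/-- A character at which the penalised elements vanish is a Connes-embeddable trace of defect
zero. -/
theorem zero_mem_connesValues {A : Type*} [Ring A] [StarRing A] [Algebra ℂ A]
    {ι : Type*} [Fintype ι] {μ : ι → ℝ} {x : ι → A} (χ : A →⋆ₐ[ℂ] ℂ)
    (h : ∀ i, μ i ≠ 0 → χ (x i) = 0) : (0 : ℝ) ∈ connesValues (defectPoly μ x) := by
  refine ⟨χ.toAlgHom.toLinearMap, ⟨map_one χ, fun y => ?_, fun y => ?_, fun y z => ?_⟩,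
    ⟨(StarAlgHom.ofId ℂ UltraR).comp χ, fun a => hasUltraTrace_algebraMap (χ a)⟩, ?_⟩
  · change 0 ≤ (χ (star y * y)).re
    rw [map_mul, map_star, Complex.star_def, ← Complex.normSq_eq_conj_mul_self]
    exact Complex.normSq_nonneg _
  · change (χ (star y * y)).im = 0
    rw [map_mul, map_star, Complex.star_def, ← Complex.normSq_eq_conj_mul_self]
    exact Complex.ofReal_im _
  · change χ (y * z) = χ (z * y)
    rw [map_mul, map_mul, mul_comm]
  · change 0 = (χ (defectPoly μ x)).re
    rw [defectPoly, map_sum, Finset.sum_eq_zero, Complex.zero_re]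
    intro i _
    by_cases hi : μ i = 0
    · simp [hi]
    · rw [map_smul, map_mul, h i hi, mul_zero, smul_zero]

/-! ### Homomorphisms to a bipartite graph -/

section Feasible

variable {W V : Type*}

/-- The digraph `H` is two-colourable, and edgeless if `G` is. -/
def Feasible (H : Digraph W) (G : SimpleGraph V) : Prop :=
  (∃ c : W → Bool, ∀ x y, H.Adj x y → c x ≠ c y) ∧
    ((∃ x y, H.Adj x y) → ∃ u v, G.Adj u v)

/-- The colour classes go to the two ends of one edge of `G`; symmetry of `G` takes care of both
orientations. Without edges in `H` a constant map will do, and this is where `hV` enters. -/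
theorem Feasible.exists_hom {H : Digraph W} {G : SimpleGraph V} (h : Feasible H G)
    (hV : Nonempty W → Nonempty V) : ∃ f : W → V, ∀ x y, H.Adj x y → G.Adj (f x) (f y) := by
  obtain ⟨⟨c, hc⟩, he⟩ := h
  by_cases hE : ∃ x y, H.Adj x y
  · obtain ⟨u, v, huv⟩ := he hE
    refine ⟨fun x => if c x then u else v, fun x y hxy => ?_⟩
    have := hc x y hxy
    cases h1 : c x <;> cases h2 : c y <;> simp_all [huv.symm]
  · push Not at hE
    rcases isEmpty_or_nonempty W with hW | hW
    · exact ⟨isEmptyElim, fun x => isEmptyElim x⟩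
    · obtain ⟨v⟩ := hV hW
      exact ⟨fun _ => v, fun x y hxy => absurd hxy (hE x y)⟩

variable {H : Digraph W} {G : SimpleGraph V} {κ : V → Bool}

theorem coord_one_eq_not (hκ : ∀ u v, G.Adj u v → κ u ≠ κ v) (d : Edge (ofGraph G)) :
    κ (d.coord 1) = !κ (d.coord 0) := by
  have h : κ d.1.1 ≠ κ d.1.2 := hκ _ _ d.2
  change κ d.1.2 = !κ d.1.1
  revert h
  cases κ d.1.1 <;> cases κ d.1.2 <;> simp

variable [Fintype V]

theorem nonempty_of_sum_eq_one {α R : Type*} [Fintype α] [Ring R] [Nontrivial R] {p : α → R}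
    (hp : ∑ a, p a = 1) : Nonempty α := by
  by_contra h
  rw [not_nonempty_iff] at h
  simp at hp

/-- Operator solutions of the assignment relations are feasible. -/
theorem feasible_of_assignment {R : Type*} [Ring R] [Nontrivial R]
    (hκ : ∀ u v, G.Adj u v → κ u ≠ κ v) (p : W → V → R) (hp : ∀ x, ∑ u, p x u = 1)
    (h : ∀ x y u v, H.Adj x y → ¬ G.Adj u v → p x u * p y v = 0) :
    Feasible H G ∧ (Nonempty W → Nonempty V) := by
  have hmul : ∀ x y, H.Adj x y → event (p x) κ * event (p y) κ = 0 := fun x y hxy =>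
    event_mul_event_eq_zero fun u v hu hv =>
      h x y u v hxy fun huv => hκ u v huv (hu.trans hv.symm)
  refine ⟨⟨exists_coloring_of_idempotents H (fun x => event (p x) κ) hmul fun x y hxy => ?_,
    ?_⟩, ?_⟩
  -- The other colour gives `(1 - q x) * (1 - q y) = 0`. With `q x * q y = 0` this expands to `q x +
  -- q y = 1`.
  · have h1 := event_mul_event_eq_zero (p := p x) (p' := p y) (S := fun u => !κ u)
      (S' := fun v => !κ v) fun u v hu hv => h x y u v hxy fun huv => by
        have := hκ u v huv
        simp_all
    rw [event_not (hp x), event_not (hp y), sub_mul, mul_sub, mul_sub, hmul x y hxy,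
      one_mul, mul_one, one_mul, sub_zero, sub_sub, add_comm] at h1
    exact (sub_eq_zero.1 h1).symm
  · rintro ⟨x, y, hxy⟩
    by_contra! hG
    have h1 : (∑ u, p x u) * ∑ v, p y v = 0 := by
      rw [Finset.sum_mul_sum]
      exact Finset.sum_eq_zero fun u _ => Finset.sum_eq_zero fun v _ => h x y u v hxy (hG u v)
    rw [hp, hp, one_mul] at h1
    exact one_ne_zero h1
  · rintro ⟨x⟩
    exact nonempty_of_sum_eq_one (hp x)

/-- If the events that the ends of a constraint lie in a colour class are represented by
idempotents attached to the variables, then the system is feasible. -/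
theorem feasible_of_constraints {R : Type*} [Ring R] [Nontrivial R]
    (hκ : ∀ u v, G.Adj u v → κ u ≠ κ v) (Φ : Edge H → Edge (ofGraph G) → R)
    (hΦ : ∀ e, IsPVM (Φ e)) (q : W → R)
    (hq : ∀ e i, q (e.coord i) = event (Φ e) fun d => κ (d.coord i)) : Feasible H G := by
  have h0 : ∀ e : Edge H, q e.1.1 = event (Φ e) fun d => κ (d.coord 0) := fun e => hq e 0
  -- The ends of an edge of `G` have opposite colours, so the two ends of `e` give complementary
  -- events of one measure `Φ e`.
  have h1 : ∀ e : Edge H, q e.1.2 = event (Φ e) fun d => !κ (d.coord 0) := fun e => by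
    have h2 := hq e 1
    simp only [coord_one_eq_not hκ] at h2
    exact h2
  refine ⟨exists_coloring_of_idempotents H q (fun x y hxy => ?_) fun x y hxy => ?_, ?_⟩
  · rw [h0 ⟨(x, y), hxy⟩, h1 ⟨(x, y), hxy⟩]
    refine event_mul_event_eq_zero fun d d' hd hd' => (hΦ _).orth d d' ?_
    rintro rfl
    simp_all
  · rw [h0 ⟨(x, y), hxy⟩, h1 ⟨(x, y), hxy⟩, event_add_not (hΦ _).sum_eq]
  · rintro ⟨x, y, hxy⟩
    obtain ⟨d⟩ := nonempty_of_sum_eq_one (hΦ ⟨(x, y), hxy⟩).sum_eq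
    exact ⟨_, _, d.2⟩

/-- The relation says that `Φ e d` absorbs `p (e.coord i) (d.coord i)` on the right. Multiplying the
colour event at a variable by `∑ d, Φ e d = 1` thus turns it into an event of `Φ e`. -/
theorem feasible_of_constraint_variable {R : Type*} [Ring R] [Nontrivial R]
    (hκ : ∀ u v, G.Adj u v → κ u ≠ κ v) (Φ : Edge H → Edge (ofGraph G) → R)
    (hΦ : ∀ e, IsPVM (Φ e)) (p : W → V → R) (hp : ∀ x, IsPVM (p x))
    (h : ∀ e d i, Φ e d * (1 - p (e.coord i) (d.coord i)) = 0) : Feasible H G := by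
  refine feasible_of_constraints hκ Φ hΦ (fun x => event (p x) κ) fun e i => ?_
  have h1 : ∀ d, Φ e d * event (p (e.coord i)) κ = if κ (d.coord i) then Φ e d else 0 := by
    intro d
    have h2 := h e d i
    rw [mul_sub, mul_one, sub_eq_zero] at h2
    rw [h2, mul_assoc, (hp _).mul_event]
    split_ifs <;> simp
  calc event (p (e.coord i)) κ = (∑ d, Φ e d) * event (p (e.coord i)) κ := by
        rw [(hΦ e).sum_eq, one_mul]
    _ = _ := by rw [Finset.sum_mul]; exact Finset.sum_congr rfl fun d _ => h1 d

/-- Here the variables have no measures of their own. The colour event of `Φ e` at one end depends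
only on the variable there: for two constraints sharing it, `E * (1 - E') = 0` and `(1 - E) * E' =
0` give `E = E * E' = E'`. -/
theorem feasible_of_constraint_constraint {R : Type*} [Ring R] [Nontrivial R]
    (hκ : ∀ u v, G.Adj u v → κ u ≠ κ v) (Φ : Edge H → Edge (ofGraph G) → R)
    (hΦ : ∀ e, IsPVM (Φ e))
    (h : ∀ e e' d d', (∃ i j, e.coord i = e'.coord j ∧ d.coord i ≠ d'.coord j) →
      Φ e d * Φ e' d' = 0) : Feasible H G := by
  classical
  let E : Edge H → Fin 2 → R := fun e i => event (Φ e) fun d => κ (d.coord i)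
  have hE : ∀ e e' i j, e.coord i = e'.coord j → E e i = E e' j := by
    intro e e' i j hij
    have h1 : E e i * (1 - E e' j) = 0 := by
      rw [← event_not (hΦ e').sum_eq]
      refine event_mul_event_eq_zero fun d d' hd hd' => h e e' d d' ⟨i, j, hij, fun hd0 => ?_⟩
      simp_all
    have h2 : (1 - E e i) * E e' j = 0 := by
      rw [← event_not (hΦ e).sum_eq]
      refine event_mul_event_eq_zero fun d d' hd hd' => h e e' d d' ⟨i, j, hij, fun hd0 => ?_⟩
      simp_all
    rw [mul_sub, mul_one, sub_eq_zero] at h1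
    rw [sub_mul, one_mul, sub_eq_zero] at h2
    rw [h1, ← h2]
  refine feasible_of_constraints hκ Φ hΦ
    -- Variables in no constraint receive the irrelevant value `0`.
    (fun x => if hx : ∃ k : Edge H × Fin 2, k.1.coord k.2 = x then E hx.choose.1 hx.choose.2
      else 0) fun e i => ?_
  have hx : ∃ k : Edge H × Fin 2, k.1.coord k.2 = e.coord i := ⟨(e, i), rfl⟩
  rw [dif_pos hx]
  exact hE _ _ _ _ hx.choose_spec

end Feasible

/-! ### The three models -/

theorem unif_nonneg (X : Type*) [Fintype X] : 0 ≤ unif X := by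
  unfold unif; positivity

theorem unif_pos {X : Type*} [Fintype X] (x : X) : 0 < unif X := by
  have : 0 < Fintype.card X := Fintype.card_pos_iff.2 ⟨x⟩
  unfold unif; positivity

section Models

variable {W V : Type*} {H : Digraph W} {G : SimpleGraph V} {κ : V → Bool}

/-- The constraint assignment induced by a homomorphism. -/
def edgeMap (f : W → V) (hf : ∀ x y, H.Adj x y → G.Adj (f x) (f y)) (e : Edge H) :
    Edge (ofGraph G) := ⟨(f e.1.1, f e.1.2), hf _ _ e.2⟩

theorem coord_edgeMap (f : W → V) (hf : ∀ x y, H.Adj x y → G.Adj (f x) (f y)) (e : Edge H)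
    (i : Fin 2) : (edgeMap f hf e).coord i = f (e.coord i) := by
  fin_cases i <;> rfl

variable [Fintype W] [Fintype V]

/-- The relations hold exactly in the quotient by the null ideal. In the models with a measure at
each variable, its sum being `1 ≠ 0` also forces `V` to be nonempty; the constraint-constraint
algebra does not see isolated variables. -/
theorem feasible_of_defect_nonpos (hκ : ∀ u v, G.Adj u v → κ u ≠ κ v) (w : Model)
    (h : ∃ r ∈ defects w H (ofGraph G), r ≤ 0) :
    Feasible H G ∧ (w ≠ .cc → Nonempty W → Nonempty V) := by
  classical
  obtain ⟨r, hr, hr0⟩ := h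
  cases w with
  | cc =>
    obtain ⟨c, hc, h⟩ := exists_ringHom_of_defect_nonpos
      (fun k => by split_ifs; exacts [unif_nonneg _, le_rfl]) hr hr0
    refine ⟨feasible_of_constraint_constraint hκ (fun e d => c.mk' (gen e d))
      (fun e => (isPVM_gen e).map c.mk') fun e e' d d' hd => ?_, fun h => absurd rfl h⟩
    rw [← map_mul]
    refine h ((e, e'), (d, d')) ?_
    rw [if_pos hd]
    exact unif_pos (e, e')
  | cv =>
    obtain ⟨c, hc, h⟩ := exists_ringHom_of_defect_nonpos
      (fun k => div_nonneg (unif_nonneg _) zero_le_two) hr hr0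
    have hp : ∀ x, IsPVM fun u : V => c.mk' (gen (Ans := AnsCV H (ofGraph G)) (.inr x) u) :=
      fun x => (isPVM_gen (Ans := AnsCV H (ofGraph G)) (.inr x)).map c.mk'
    refine ⟨feasible_of_constraint_variable hκ
      (fun e d => c.mk' (gen (Ans := AnsCV H (ofGraph G)) (.inl e) d))
      (fun e => (isPVM_gen (Ans := AnsCV H (ofGraph G)) (.inl e)).map c.mk') _ hp
      fun e d i => ?_, fun _ ⟨x⟩ => nonempty_of_sum_eq_one (hp x).sum_eq⟩
    rw [← map_one c.mk', ← map_sub, ← map_mul]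
    exact h (e, d, i) (half_pos (unif_pos e))
  | a =>
    obtain ⟨c, hc, h⟩ := exists_ringHom_of_defect_nonpos
      (fun k => by split_ifs; exacts [le_rfl, unif_nonneg _]) hr hr0
    have h1 := feasible_of_assignment (H := H) (G := G) hκ (fun x u => c.mk' (gen x u))
      (fun x => ((isPVM_gen x).map c.mk').sum_eq) fun x y u v hxy huv => by
        rw [← map_mul]
        exact h (⟨(x, y), hxy⟩, u, v)
          ((unif_pos (X := Edge H) ⟨(x, y), hxy⟩).trans_eq (if_neg huv).symm)
    exact ⟨h1.1, fun _ => h1.2⟩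

theorem zero_mem_defects (w : Model) (h : Feasible H G)
    (hV : w ≠ .cc → Nonempty W → Nonempty V) : (0 : ℝ) ∈ defects w H (ofGraph G) := by
  classical
  cases w with
  | cc =>
    by_cases hE : ∃ x y, H.Adj x y
    · obtain ⟨f, hf⟩ := h.exists_hom fun _ => by
        obtain ⟨u, -, -⟩ := h.2 hE
        exact ⟨u⟩
      refine zero_mem_connesValues (character (edgeMap f hf)) ?_
      rintro ⟨⟨e, e'⟩, d, d'⟩ hk
      rw [ne_eq, ite_eq_right_iff, not_forall] at hk
      obtain ⟨⟨i, j, hij, hd⟩, -⟩ := hk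
      rw [map_mul, character_gen, character_gen]
      split_ifs with h1 h2
      · simp only at hij hd h1 h2
        rw [h1, h2, coord_edgeMap, coord_edgeMap, hij] at hd
        exact absurd rfl hd
      all_goals simp
    -- There need not be any map `W → V` here, but the algebra has no generators, so the choice of
    -- answers is vacuous.
    · have hem : IsEmpty (Edge H) := ⟨fun e => hE ⟨_, _, e.2⟩⟩
      exact zero_mem_connesValues (character fun e => isEmptyElim e) fun k => isEmptyElim k.1.1
  | cv =>
    obtain ⟨f, hf⟩ := h.exists_hom (hV (by simp))
    let s : ∀ q, AnsCV H (ofGraph G) q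
      | .inl e => edgeMap f hf e
      | .inr x => f x
    refine zero_mem_connesValues (character s) ?_
    rintro ⟨e, d, i⟩ -
    rw [map_mul, map_sub, map_one]
    by_cases hd : d = edgeMap f hf e
    · subst hd
      refine mul_eq_zero_of_right _ (sub_eq_zero.2 ?_)
      exact ((character_gen s (.inr (e.coord i)) _).trans (if_pos (coord_edgeMap f hf e i))).symm
    · exact mul_eq_zero_of_left ((character_gen s (.inl e) d).trans (if_neg hd)) _
  | a =>
    obtain ⟨f, hf⟩ := h.exists_hom (hV (by simp))
    refine zero_mem_connesValues (character f) ?_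
    rintro ⟨e, u, v⟩ hk
    rw [map_mul, character_gen, character_gen]
    split_ifs with h1 h2
    · simp only at h1 h2
      subst h1 h2
      exact absurd (if_pos (hf _ _ e.2)) hk
    all_goals simp

end Models

open Classical in
/-- Feasibility is expressed by a system of parity constraints. -/
theorem exists_satisfiable_iff_feasible {V : Type*} (G : SimpleGraph V) (P : Prop) :
    ∃ g : Bool → Parity, ∀ (n : ℕ) (H : Digraph (Fin n)),
      (Satisfiable fun i j => g (decide (H.Adj i j))) ↔
        Feasible H G ∧ (P → Nonempty (Fin n) → Nonempty V) := by
  by_cases hE : ∃ u v, G.Adj u v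
  -- Edges demand different bits, non-edges demand nothing.
  · refine ⟨fun b => (false, b), fun n H => ?_⟩
    have hV : Nonempty V := let ⟨u, _⟩ := hE; ⟨u⟩
    simp [Satisfiable, Feasible, Parity.Holds, hE, hV]
  by_cases hV : P → Nonempty V
  -- As `G` is edgeless, every edge of `H` must be a contradiction.
  · refine ⟨fun b => (b, b), fun n H => ⟨?_, ?_⟩⟩
    · rintro ⟨c, hc⟩
      have h : ∀ x y, ¬ H.Adj x y := fun x y hxy => by simpa [hxy, Parity.Holds] using hc x y
      exact ⟨⟨⟨c, fun x y hxy => absurd hxy (h x y)⟩, fun ⟨x, y, hxy⟩ => absurd hxy (h x y)⟩,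
        fun hP _ => hV hP⟩
    · rintro ⟨⟨-, h⟩, -⟩
      have h' : ∀ x y, ¬ H.Adj x y := fun x y hxy => hE (h ⟨x, y, hxy⟩)
      exact ⟨fun _ => true, fun x y => by simp [h', Parity.Holds]⟩
  · rw [Classical.not_imp] at hV
    -- As `V` is empty and `P` holds, any vertex of `H` must be a contradiction, already through its
    -- diagonal entry.
    refine ⟨fun _ => (true, true), fun n H => ⟨?_, ?_⟩⟩
    · rintro ⟨c, hc⟩
      have : IsEmpty (Fin n) := ⟨fun i => by simpa [Parity.Holds] using hc i i⟩
      exact ⟨⟨⟨fun _ => true, fun x => isEmptyElim x⟩, fun ⟨x, _⟩ => isEmptyElim x⟩,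
        fun _ ⟨x⟩ => isEmptyElim x⟩
    · rintro ⟨-, h⟩
      have : IsEmpty (Fin n) := not_nonempty_iff.1 fun hn => hV.2 (h hV.1 hn)
      exact ⟨fun _ => true, fun x => isEmptyElim x⟩

/-! ### The quantum homomorphism space -/

instance : Nontrivial Op := by
  refine ⟨1, 0, fun h2 => ?_⟩
  have h3 : delta (0 : ℕ) = 0 := DFunLike.congr_fun h2 (delta 0)
  have h4 : delta (0 : ℕ) 0 = (1 : ℂ) := by simp [delta]
  rw [h3] at h4
  exact zero_ne_one h4

/-- `MorPlus` is a unital algebra of functions on the set of representations: if that set is empty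
the algebra is zero, and otherwise evaluation at a representation separates `1` from `0`. -/
theorem nontrivial_morPlus_iff {W V : Type*} [Fintype V] (H : Digraph W) (A : Digraph V) :
    Nontrivial (MorPlus H A) ↔ Nonempty (QRep H A) := by
  constructor
  · intro h
    by_contra hem
    rw [not_nonempty_iff] at hem
    obtain ⟨x, y, hxy⟩ := h
    exact hxy (Subtype.ext (BoundedContinuousFunction.ext fun ρ => isEmptyElim ρ))
  · rintro ⟨ρ⟩
    refine ⟨1, 0, fun h => ?_⟩
    have h1 : (1 : BoundedContinuousFunction (QRep H A) Op) = 0 := congrArg Subtype.val h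
    exact one_ne_zero (α := Op) (DFunLike.congr_fun h1 ρ)

open Classical in
/-- The classical representation given by a homomorphism. -/
noncomputable def QRep.ofHom {W V : Type*} [Fintype V] {H : Digraph W} {A : Digraph V}
    (f : W → V) (hf : ∀ x y, H.Adj x y → A.Adj (f x) (f y)) : QRep H A where
  p x u := if u = f x then 1 else 0
  proj x u := by split_ifs; exacts [.one _, .zero _]
  sum_eq x := by simp
  rel x y u v hxy huv := by
    split_ifs with h1 h2
    · exact absurd (h1 ▸ h2 ▸ hf x y hxy) huv
    all_goals simp

end EntangledCSP

open EntangledCSP in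
theorem mainTheorem12 {V : Type*} [Fintype V] (G : SimpleGraph V) (hG : G.IsBipartite) :
    (∀ (w : EntangledCSP.Model) (s : ℝ) (hs : s ≤ 1),
      EntangledCSP.entangledCSP w (EntangledCSP.ofGraph G) 1 s hs ∈ EntangledCSP.classP) ∧
    (∀ (W : Type*) [Fintype W] (H : Digraph W),
      Nontrivial (EntangledCSP.MorPlus H (EntangledCSP.ofGraph G)) ↔
        ∃ f : W → V, ∀ x y, H.Adj x y → G.Adj (f x) (f y)) := by
  obtain ⟨κ, hκ⟩ : ∃ κ : V → Bool, ∀ u v, G.Adj u v → κ u ≠ κ v := by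
    obtain ⟨C⟩ := hG
    exact ⟨fun v => finTwoEquiv (C v), fun u v h => finTwoEquiv.injective.ne (C.valid h)⟩
  refine ⟨fun w s hs => ?_, fun W _ H => ?_⟩
  · obtain ⟨g, hg⟩ := exists_satisfiable_iff_feasible G (w ≠ .cc)
    refine entangledCSP_mem_classP w _ 1 s hs g (fun n B h => ?_) fun n B h hsat => ?_
    · rw [sub_self] at h
      exact (hg n B).2 (feasible_of_defect_nonpos hκ w h)
    · have h0 := (hg n B).1 hsat
      -- Defect zero in a no instance would give `1 - s < 0`, against `s ≤ 1`.
      linarith [h 0 (zero_mem_defects w h0.1 h0.2)]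
  · rw [nontrivial_morPlus_iff]
    constructor
    · rintro ⟨ρ⟩
      have h := feasible_of_assignment (H := H) hκ ρ.p ρ.sum_eq fun x y u v => ρ.rel x y u v
      exact h.1.exists_hom h.2
    · rintro ⟨f, hf⟩
      exact ⟨QRep.ofHom f hf⟩
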